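/- **Setting.** Let $\Theta\subset\mathbb R^d$ be convex and bounded, let $\theta$ be an interior point of $\Theta$, and let $P_\theta$ be a probability law on $\mathbb R^d$, with expectation $E_\theta$. Let $X_i=(X_{i1},\dots,X_{im_i})$, $i\ge 1$, $m_i\ge 1$, be independent clusters of $\mathbb R^d$-valued random variables, all $X_{ij}$ having law $P_\theta$, such that within each cluster $i$ all pairs $(X_{ij},X_{ij'})$, $j\ne j'$, have the same law. Put $N_n=\sum_{i=1}^n m_i$ and suppose $N_n/n\to\ell\in(0,\infty)$. Let $w_{ij}>0$ be non-random weights, let $\rho:\mathbb R^d\times\mathbb R^d\to\mathbb R$ with $\rho(\cdot,a)$ measurable for each $a\in\Theta$, and let $\hat\theta_n^w$ be random vectors such that, almost surely for all sufficiently large $n$, $\hat\theta_n^w\in\Theta$ minimizes $M_n^w(a)=\frac1{N_n}\sum_{i=1}^n\sum_{j=1}^{m_i}w_{ij}\,\rho(X_{ij},a)$ over $a\in\Theta$. **Assumptions (A1).** (a) For every $\epsilon>0$, $\inf_{a\in\Theta,\ \|a-\theta\|>\epsilon}E_\theta\rho(X_{11},a)>E_\theta\rho(X_{11},\theta)$.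 (b) $E_\theta\rho^2(X_{11},a)<\infty$ for all $a\in\Theta$. (c) $\frac1{N_n}\sum_{i=1}^n\sum_{j=1}^{m_i}w_{ij}\to1$. (d) $\sum_{i\ge1}w_{i\cdot}^2/i^2<\infty$, where $w_{i\cdot}=\sum_{j=1}^{m_i}w_{ij}$. **Hölder condition.** There are $\lambda\in(0,1]$ and a function $k$ with $E_\theta k^2(X_{11})<\infty$ such that $|\rho(x,a_1)-\rho(x,a_2)|\le k(x)\|a_1-a_2\|^\lambda$ for all $x\in\mathbb R^d$ and $a_1,a_2\in\Theta$. **Smoothness.** There is a neighborhood $U$ of $\theta$ such that for every $x$ the function $\rho(x,\cdot)$ is differentiable on $U$, with gradient $\psi(x,\cdot)$; $\psi(x,\cdot)$ is twice differentiable on $U$; and all its partial derivatives of order 2 are bounded in absolute value on $U$ by $F(x)$, where $F$ does not depend on $a$ and $E_\theta F^2(X_{11})<\infty$. The entries of $\frac{\partial\psi(X_{11},a)}{\partial a}\big|_{a=\theta}$ are square integrable, and $V_\theta:=E_\theta\big(\frac{\partial\psi(X_{11},a)}{\partial a}\big|_{a=\theta}\big)$ is invertible. **Assumptions (A2).** (a)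 $\frac1{N_n}\sum_{i=1}^n\sum_{j=1}^{m_i}w_{ij}^2\to c_w$ for some finite $c_w$. (b) With $C_i=E_\theta\,\psi(X_{ij},\theta)\psi^{T}(X_{ij'},\theta)$ ($j\ne j'$), $\frac1{N_n}\sum_{i=1}^n\sum_{j=1}^{m_i}\sum_{j'\ne j}w_{ij}w_{ij'}C_i\to C_\theta^w$ for some matrix $C_\theta^w$. (c) For some $\eta>0$, $\frac1{N_n}\sum_{i=1}^n w_{i\cdot}^{2+\eta}$ converges to a finite limit and $E_\theta\|\psi(X_{11},\theta)\|^{2+\eta}<\infty$. **Conclusion.** With $B_\theta:=E_\theta\,\psi(X_{11},\theta)\psi^{T}(X_{11},\theta)$, the matrix $\Sigma_\theta^w:=V_\theta^{-1}\,(c_wB_\theta+C_\theta^w)\,V_\theta^{-1}$ is symmetric positive semidefinite, and $$\sqrt{N_n}\,\big(\hat\theta_n^w-\theta\big)\xrightarrow[n\to\infty]{d}N\big(0,\Sigma_\theta^w\big).$$ -/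

import Mathlib

open Filter Topology MeasureTheory ProbabilityTheory Finset

noncomputable section

namespace WeightedM

variable {d : ℕ}

/-- `N_n`: the total number of variables in the first `n` clusters (clusters are numbered
`0, 1, 2, …`, so that the first `n` clusters are those with index `i < n`). -/
def totalSize (m : ℕ → ℕ) (n : ℕ) : ℕ := ∑ i ∈ range n, m i

/-- The theoretical criterion `M(a) = ∫ ρ(x, a) dP(x)`. -/
def risk (P : Measure (EuclideanSpace ℝ (Fin d)))
    (ρ : EuclideanSpace ℝ (Fin d) → EuclideanSpace ℝ (Fin d) → ℝ)
    (a : EuclideanSpace ℝ (Fin d)) : ℝ :=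
  ∫ x, ρ x a ∂P

/-- The weighted empirical criterion
`M_n^w(a) = N_n⁻¹ ∑_{i ≤ n} ∑_{j ≤ m_i} w_{ij} ρ(X_{ij}, a)`, at the outcome `ω`. -/
def weightedRisk {Ω : Type*} (m : ℕ → ℕ) (w : (i : ℕ) → Fin (m i) → ℝ)
    (X : (i : ℕ) → Fin (m i) → Ω → EuclideanSpace ℝ (Fin d))
    (ρ : EuclideanSpace ℝ (Fin d) → EuclideanSpace ℝ (Fin d) → ℝ)
    (n : ℕ) (ω : Ω) (a : EuclideanSpace ℝ (Fin d)) : ℝ :=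
  (1 / (totalSize m n : ℝ)) * ∑ i ∈ range n, ∑ j, w i j * ρ (X i j ω) a

/-- `ψ(x, a)`: the vector of partial derivatives of `ρ(x, ·)` at `a`. -/
def psi (ρ : EuclideanSpace ℝ (Fin d) → EuclideanSpace ℝ (Fin d) → ℝ)
    (x a : EuclideanSpace ℝ (Fin d)) : EuclideanSpace ℝ (Fin d) :=
  gradient (ρ x) a

/-- The Jacobian matrix of `ψ(x, ·)` at `a`, with entries `∂ψ_k(x, a)/∂a_l`. -/
def psiDot (ρ : EuclideanSpace ℝ (Fin d) → EuclideanSpace ℝ (Fin d) → ℝ)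
    (x a : EuclideanSpace ℝ (Fin d)) : Matrix (Fin d) (Fin d) ℝ :=
  Matrix.of fun k l => (fderiv ℝ (psi ρ x) a (EuclideanSpace.single l 1)) k

/-- The partial derivative of order two `∂²ψ_k(x, a)/(∂a_p ∂a_l)`. -/
def psiDDot (ρ : EuclideanSpace ℝ (Fin d) → EuclideanSpace ℝ (Fin d) → ℝ)
    (x a : EuclideanSpace ℝ (Fin d)) (k l p : Fin d) : ℝ :=
  (fderiv ℝ (fderiv ℝ (psi ρ x)) a (EuclideanSpace.single p 1) (EuclideanSpace.single l 1)) k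

/-- `B_θ = ∫ ψ(x, θ) ψ(x, θ)ᵀ dP(x)`. -/
def matB (P : Measure (EuclideanSpace ℝ (Fin d)))
    (ρ : EuclideanSpace ℝ (Fin d) → EuclideanSpace ℝ (Fin d) → ℝ)
    (θ : EuclideanSpace ℝ (Fin d)) : Matrix (Fin d) (Fin d) ℝ :=
  Matrix.of fun k l => ∫ x, psi ρ x θ k * psi ρ x θ l ∂P

/-- `V_θ = ∫ ∂ψ(x, a)/∂a |_{a = θ} dP(x)`. -/
def matV (P : Measure (EuclideanSpace ℝ (Fin d)))
    (ρ : EuclideanSpace ℝ (Fin d) → EuclideanSpace ℝ (Fin d) → ℝ)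
    (θ : EuclideanSpace ℝ (Fin d)) : Matrix (Fin d) (Fin d) ℝ :=
  Matrix.of fun k l => ∫ x, psiDot ρ x θ k l ∂P

/-- `E[ψ(Y, θ) ψ(Y', θ)ᵀ]` for two random vectors `Y`, `Y'`. For `Y = X_{ij}`, `Y' = X_{ij'}` with
`j ≠ j'` this is the matrix `C_i`; it is the same for all such pairs in a cluster whose pairs are
identically distributed. -/
def crossMoment {Ω : Type*} [MeasurableSpace Ω] (μ : Measure Ω)
    (ρ : EuclideanSpace ℝ (Fin d) → EuclideanSpace ℝ (Fin d) → ℝ)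
    (θ : EuclideanSpace ℝ (Fin d)) (Y Y' : Ω → EuclideanSpace ℝ (Fin d)) :
    Matrix (Fin d) (Fin d) ℝ :=
  Matrix.of fun k l => ∫ ω, psi ρ (Y ω) θ k * psi ρ (Y' ω) θ l ∂μ

/-- The asymptotic covariance matrix `V_θ⁻¹ (c_w B_θ + C_θ^w) V_θ⁻¹`. -/
def asympCov (P : Measure (EuclideanSpace ℝ (Fin d)))
    (ρ : EuclideanSpace ℝ (Fin d) → EuclideanSpace ℝ (Fin d) → ℝ)
    (θ : EuclideanSpace ℝ (Fin d)) (cw : ℝ) (Cw : Matrix (Fin d) (Fin d) ℝ) :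
    Matrix (Fin d) (Fin d) ℝ :=
  (matV P ρ θ)⁻¹ * (cw • matB P ρ θ + Cw) * (matV P ρ θ)⁻¹

end WeightedM

end

open WeightedM

noncomputable section

/-! Write `h = θhat - θ`, `S` for the weighted mean of `ψ(·, θ)` and `A` for that of the Jacobians
at `θ`. Once the estimator is interior it cancels the weighted score, and Taylor's formula at `θ`
gives `S + A h = O(‖h‖²)`, the constant being a multiple of the weighted mean of `|F|`. Since `A →
V` and `h → 0`, this says `h = -V⁻¹ S` up to an error that is `o(1)` relative to `‖V⁻¹ S‖`. Hence
`√N h` should have the limit law of `-√N V⁻¹ S`, which is `linearTerm`.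

The vector `S` is a normalized sum of independent cluster sums, centered because `θ` minimizes the
risk (`integral_inner_psi_eq_zero`). Whatever the dependence inside a cluster, Jensen's inequality
bounds the `p`-th moment of its sum by the `p`-th power of its total weight times the moment of one
observation (`integral_abs_clusterSum_rpow_le`). The moment condition of order `2 + η` on the total
weights thus yields Lyapunov's condition, and characteristic functions give
`tendstoInDistribution_linearTerm`.

The remainder needs to vanish only in probability, so almost sure convergence along sparse
subsequences suffices. There the variances of weighted means are summable
(`ae_tendsto_weightedMean`). The Hölder condition and countably many net points upgrade this to
uniform convergence of the criterion, hence to consistency (`tendstoUniformlyOn_of_holder`,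
`tendsto_of_isMinOn`). The linearization is `tendsto_smul_sub_linearTerm`, and Slutsky's theorem
concludes. -/

namespace WeightedM

/-! ### Lyapunov's theorem by characteristic functions -/

/-- Second order Taylor bound for the complex exponential on the imaginary axis, with a power
`|x| ^ p`, `2 ≤ p ≤ 3`, as remainder. -/
lemma norm_cexp_mul_I_sub_le {p : ℝ} (hp2 : 2 ≤ p) (hp3 : p ≤ 3) (x : ℝ) :
    ‖Complex.exp (x * Complex.I) - (1 + x * Complex.I - x ^ 2 / 2)‖ ≤ 4 * |x| ^ p := by
  have hI : Complex.I ^ 2 = -1 := Complex.I_sq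
  by_cases hx : |x| ≤ 1
  · have h := Complex.exp_bound' (x := (x : ℂ) * Complex.I) (n := 3) (by
      simp only [norm_mul, Complex.norm_I, Complex.norm_real, Real.norm_eq_abs, mul_one]
      push_cast
      linarith)
    have e : ∑ m ∈ range 3, ((x : ℂ) * Complex.I) ^ m / (m.factorial : ℂ)
        = 1 + x * Complex.I - x ^ 2 / 2 := by
      simp [Finset.sum_range_succ, mul_pow, hI]
      ring
    rw [e] at h
    refine h.trans ?_
    simp only [norm_mul, Complex.norm_I, Complex.norm_real, Real.norm_eq_abs, mul_one]
    have h3 : |x| ^ (3 : ℕ) ≤ |x| ^ p := by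
      rw [← Real.rpow_natCast]
      exact Real.rpow_le_rpow_of_exponent_ge' (abs_nonneg x) hx (by linarith) (by push_cast; exact hp3)
    have h0 : 0 ≤ |x| ^ (3 : ℕ) := by positivity
    norm_num [Nat.factorial]
    linarith
  -- Here `1`, `|x|` and `x²` are all at most `|x|^p`, and the triangle inequality gives `2 + |x| +
  -- x²/2`, at most `7/2` such terms; this regime dictates the constant `4`.
  · push Not at hx
    have h2 : |x| ^ (2 : ℕ) ≤ |x| ^ p := by
      rw [← Real.rpow_natCast]
      exact Real.rpow_le_rpow_of_exponent_le hx.le (by push_cast; exact hp2)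
    have h1 : ‖Complex.exp (x * Complex.I) - (1 + x * Complex.I - x ^ 2 / 2)‖
        ≤ 1 + (1 + |x| + |x| ^ 2 / 2) := by
      refine (norm_sub_le _ _).trans (add_le_add (by simp [Complex.norm_exp_ofReal_mul_I]) ?_)
      refine (norm_sub_le _ _).trans (add_le_add ((norm_add_le _ _).trans ?_) ?_)
      · simp
      · simp
    nlinarith

/-- First order Taylor bound for `exp (-u)`, with a power `u ^ q`, `1 ≤ q ≤ 2`, as remainder. -/
lemma abs_exp_neg_sub_le {q : ℝ} (hq1 : 1 ≤ q) (hq2 : q ≤ 2) {u : ℝ} (hu : 0 ≤ u) :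
    |Real.exp (-u) - (1 - u)| ≤ u ^ q := by
  rcases le_or_gt u 1 with h | h
  · have h1 := Real.abs_exp_sub_one_sub_id_le (x := -u) (by rwa [abs_neg, abs_of_nonneg hu])
    have h2 : u ^ (2 : ℕ) ≤ u ^ q := by
      rw [← Real.rpow_natCast]
      exact Real.rpow_le_rpow_of_exponent_ge' hu h (by linarith) (by push_cast; exact hq2)
    calc _ = |Real.exp (-u) - 1 - -u| := by congr 1; ring
      _ ≤ _ := h1
      _ ≤ _ := by rw [neg_sq]; exact h2
  · have h1 : u ^ (1 : ℝ) ≤ u ^ q := Real.rpow_le_rpow_of_exponent_le h.le hq1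
    rw [Real.rpow_one] at h1
    have h2 := Real.exp_pos (-u)
    have h3 := Real.exp_le_one_iff.2 (neg_nonpos.2 hu)
    have h4 := Real.add_one_le_exp (-u)
    rw [abs_of_nonneg (by linarith)]
    linarith

/-- Telescoping: the factors are exchanged one at a time, and the remaining ones have norm at most
`1`. It reduces the central limit theorem to a comparison of each characteristic function with a
Gaussian one. -/
lemma norm_prod_sub_prod_le_sum {ι : Type*} (s : Finset ι) (a b : ι → ℂ)
    (ha : ∀ i ∈ s, ‖a i‖ ≤ 1) (hb : ∀ i ∈ s, ‖b i‖ ≤ 1) :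
    ‖∏ i ∈ s, a i - ∏ i ∈ s, b i‖ ≤ ∑ i ∈ s, ‖a i - b i‖ := by
  classical
  induction s using Finset.induction_on with
  | empty => simp
  | insert i s hi ih =>
    rw [prod_insert hi, prod_insert hi, sum_insert hi]
    have h1 : a i * ∏ j ∈ s, a j - b i * ∏ j ∈ s, b j
        = (a i - b i) * ∏ j ∈ s, a j + b i * (∏ j ∈ s, a j - ∏ j ∈ s, b j) := by ring
    have h2 : ‖∏ j ∈ s, a j‖ ≤ 1 := by
      rw [norm_prod]
      exact prod_le_one (fun _ _ => norm_nonneg _) fun j hj => ha j (mem_insert_of_mem hj)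
    have h3 := ih (fun j hj => ha j (mem_insert_of_mem hj)) fun j hj => hb j (mem_insert_of_mem hj)
    rw [h1]
    refine (norm_add_le _ _).trans (add_le_add ?_ ?_)
    · rw [norm_mul]
      exact mul_le_of_le_one_right (norm_nonneg _) h2
    · rw [norm_mul]
      exact (mul_le_of_le_one_left (norm_nonneg _) (hb i (mem_insert_self i s))).trans h3

section

variable {Ω : Type*} [MeasurableSpace Ω] {μ : Measure Ω} [IsProbabilityMeasure μ]

/-- Second order expansion at `0` of the characteristic function of a centered variable. -/
lemma norm_charFun_map_sub_le {p : ℝ} (hp2 : 2 ≤ p) (hp3 : p ≤ 3) {Y : Ω → ℝ} (hY : MemLp Y 2 μ)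
    (hY0 : ∫ ω, Y ω ∂μ = 0) (hYp : Integrable (fun ω => |Y ω| ^ p) μ) (s : ℝ) :
    ‖charFun (μ.map Y) s - (1 - s ^ 2 * (∫ ω, Y ω ^ 2 ∂μ) / 2 : ℝ)‖
      ≤ 4 * |s| ^ p * ∫ ω, |Y ω| ^ p ∂μ := by
  have hm : AEMeasurable Y μ := hY.aemeasurable
  have hi1 : Integrable (fun ω => ((s * Y ω : ℝ) : ℂ) * Complex.I) μ :=
    (((hY.integrable (by norm_num)).const_mul s).ofReal).mul_const _
  have hi2 : Integrable (fun ω => (((s * Y ω : ℝ) : ℂ)) ^ 2 / 2) μ := by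
    have := ((hY.integrable_sq.const_mul (s ^ 2)).ofReal (𝕜 := ℂ)).div_const 2
    refine this.congr (ae_of_all _ fun ω => ?_)
    simp [mul_pow]
  have hi0 : Integrable (fun ω => Complex.exp (((s * Y ω : ℝ) : ℂ) * Complex.I)) μ := by
    refine Integrable.mono' (integrable_const (1 : ℝ)) ?_ (ae_of_all _ fun ω => ?_)
    · exact (Complex.measurable_exp.comp_aemeasurable
        ((Complex.measurable_ofReal.comp_aemeasurable (hm.const_mul s)).mul_const _)
        ).aestronglyMeasurable
    · rw [Complex.norm_exp_ofReal_mul_I]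
  have e1 : charFun (μ.map Y) s = ∫ ω, Complex.exp (((s * Y ω : ℝ) : ℂ) * Complex.I) ∂μ := by
    rw [charFun_apply_real, integral_map hm (by fun_prop)]
    push_cast
    rfl
  have e2 : ∫ ω, (((s * Y ω : ℝ) : ℂ) * Complex.I) ∂μ = 0 := by
    rw [integral_mul_const, integral_complex_ofReal, integral_const_mul, hY0]
    simp
  have e3 : ∫ ω, (((s * Y ω : ℝ) : ℂ)) ^ 2 / 2 ∂μ = ((s ^ 2 * (∫ ω, Y ω ^ 2 ∂μ) / 2 : ℝ) : ℂ) := by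
    rw [← integral_const_mul, ← integral_div, ← integral_complex_ofReal]
    refine integral_congr_ae (ae_of_all _ fun ω => ?_)
    push_cast
    ring
  have hi3 : Integrable (fun ω => 1 + ((s * Y ω : ℝ) : ℂ) * Complex.I) μ :=
    (integrable_const _).add hi1
  have hi4 : Integrable (fun ω => 1 + ((s * Y ω : ℝ) : ℂ) * Complex.I
      - (((s * Y ω : ℝ) : ℂ)) ^ 2 / 2) μ := hi3.sub hi2
  have e4 : ∫ ω, (1 + ((s * Y ω : ℝ) : ℂ) * Complex.I - (((s * Y ω : ℝ) : ℂ)) ^ 2 / 2) ∂μ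
      = ((1 - s ^ 2 * (∫ ω, Y ω ^ 2 ∂μ) / 2 : ℝ) : ℂ) := by
    rw [integral_sub hi3 hi2, integral_add (integrable_const _) hi1, e2,
      e3]
    simp
  rw [e1, ← e4, ← integral_sub hi0 hi4]
  refine (norm_integral_le_of_norm_le (hYp.const_mul (4 * |s| ^ p))
    (ae_of_all _ fun ω => ?_)).trans ?_
  · refine (norm_cexp_mul_I_sub_le hp2 hp3 _).trans (le_of_eq ?_)
    rw [abs_mul, Real.mul_rpow (abs_nonneg _) (abs_nonneg _), mul_assoc]
  · rw [integral_const_mul]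

/-- **Lyapunov's central limit theorem** for the characteristic function at `1` of the rescaled
sums `c n * ∑ i < n, Y i` of centered independent variables with moments dominated by powers
of `v i`. -/
theorem tendsto_charFun_scaled_sum {Y : ℕ → Ω → ℝ} (hindep : iIndepFun Y μ) {p : ℝ} (hp2 : 2 ≤ p)
    (hp3 : p ≤ 3) (hY : ∀ i, MemLp (Y i) 2 μ) (hY0 : ∀ i, ∫ ω, Y i ω ∂μ = 0)
    (hYp : ∀ i, Integrable (fun ω => |Y i ω| ^ p) μ) {v : ℕ → ℝ} (hv : ∀ i, 0 ≤ v i) {K : ℝ}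
    (hK : 0 ≤ K) (hK2 : ∀ i, ∫ ω, Y i ω ^ 2 ∂μ ≤ K * v i ^ 2)
    (hKp : ∀ i, ∫ ω, |Y i ω| ^ p ∂μ ≤ K * v i ^ p) {c : ℕ → ℝ} (hc : ∀ n, 0 ≤ c n) {σ : ℝ}
    (hσ : Tendsto (fun n => c n ^ 2 * ∑ i ∈ range n, ∫ ω, Y i ω ^ 2 ∂μ) atTop (𝓝 σ))
    (hlyap : Tendsto (fun n => c n ^ p * ∑ i ∈ range n, v i ^ p) atTop (𝓝 0)) :
    Tendsto (fun n => charFun (μ.map fun ω => c n * ∑ i ∈ range n, Y i ω) 1) atTop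
      (𝓝 (Complex.exp (-(σ / 2 : ℝ)))) := by
  have hm : ∀ i, AEMeasurable (Y i) μ := fun i => (hY i).aemeasurable
  have hmap : ∀ i, IsProbabilityMeasure (μ.map (Y i)) := fun i => Measure.isProbabilityMeasure_map (hm i)
  have hprod : ∀ n, charFun (μ.map fun ω => c n * ∑ i ∈ range n, Y i ω) 1
      = ∏ i ∈ range n, charFun (μ.map (Y i)) (c n) := by
    intro n
    rw [charFun_map_mul_comp, iIndepFun.charFun_map_fun_finsetSum_eq_prod (fun i _ => hm i)
      (hindep.restrict _), Finset.prod_apply, mul_one]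
    exact Finset.aemeasurable_fun_sum _ fun i _ => hm i
  -- Half the variance of `c n * Y i`, so that `exp (-u n i)` is the characteristic function at `1`
  -- of the matching Gaussian.
  set u : ℕ → ℕ → ℝ := fun n i => c n ^ 2 * (∫ ω, Y i ω ^ 2 ∂μ) / 2 with hu
  have hu0 : ∀ n i, 0 ≤ u n i := fun n i =>
    div_nonneg (mul_nonneg (sq_nonneg _) (integral_nonneg fun ω => by positivity)) (by norm_num)
  have hgauss : Tendsto (fun n => ∏ i ∈ range n, ((Real.exp (-u n i) : ℝ) : ℂ)) atTop
      (𝓝 (Complex.exp (-(σ / 2 : ℝ)))) := by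
    have h1 : Tendsto (fun n => Real.exp (-((c n ^ 2 * ∑ i ∈ range n, ∫ ω, Y i ω ^ 2 ∂μ) / 2))) atTop
        (𝓝 (Real.exp (-(σ / 2)))) :=
      (Real.continuous_exp.tendsto _).comp (hσ.div_const 2).neg
    have h2 := (Complex.continuous_ofReal.tendsto _).comp h1
    rw [Complex.ofReal_exp, Complex.ofReal_neg] at h2
    refine h2.congr fun n => ?_
    simp only [Function.comp_apply]
    rw [← Complex.ofReal_prod, ← Real.exp_sum, sum_neg_distrib, mul_sum, sum_div]
  -- Both factors are compared with `1 - u n i`: the characteristic function costs `4 * K`, and the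
  -- Gaussian one costs `u ^ (p / 2)`, which is of the same order because `u ≤ K * (c * v) ^ 2`.
  have hterm : ∀ n, ∀ i ∈ range n, ‖charFun (μ.map (Y i)) (c n) - ((Real.exp (-u n i) : ℝ) : ℂ)‖
      ≤ (4 * K + K ^ (p / 2)) * (c n ^ p * v i ^ p) := by
    intro n i _
    have h1 := norm_charFun_map_sub_le hp2 hp3 (hY i) (hY0 i) (hYp i) (c n)
    have h2 := abs_exp_neg_sub_le (q := p / 2) (by linarith) (by linarith) (hu0 n i)
    have h3 : u n i ^ (p / 2) ≤ K ^ (p / 2) * (c n ^ p * v i ^ p) := by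
      have e : K ^ (p / 2) * (c n ^ p * v i ^ p) = (K * (c n * v i) ^ 2) ^ (p / 2) := by
        rw [Real.mul_rpow hK (sq_nonneg _), ← Real.mul_rpow (hc n) (hv i), ← Real.rpow_natCast,
          ← Real.rpow_mul (mul_nonneg (hc n) (hv i))]
        congr 2
        push_cast
        ring
      rw [e]
      refine Real.rpow_le_rpow (hu0 n i) ?_ (by linarith)
      have h4 : 0 ≤ ∫ ω, Y i ω ^ 2 ∂μ := integral_nonneg fun ω => by positivity
      have h5 := mul_le_mul_of_nonneg_left (hK2 i) (sq_nonneg (c n))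
      simp only [hu]
      nlinarith [mul_nonneg (sq_nonneg (c n)) h4]
    have h4 : ‖((1 - u n i : ℝ) : ℂ) - ((Real.exp (-u n i) : ℝ) : ℂ)‖ ≤ u n i ^ (p / 2) := by
      rw [← Complex.ofReal_sub, Complex.norm_real, Real.norm_eq_abs, abs_sub_comm]
      exact h2
    have h5 : 4 * |c n| ^ p * ∫ ω, |Y i ω| ^ p ∂μ ≤ 4 * K * (c n ^ p * v i ^ p) := by
      rw [abs_of_nonneg (hc n)]
      have := mul_le_mul_of_nonneg_left (hKp i) (Real.rpow_nonneg (hc n) p)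
      nlinarith
    calc _ ≤ _ := norm_sub_le_norm_sub_add_norm_sub _ ((1 - u n i : ℝ) : ℂ) _
      _ ≤ 4 * K * (c n ^ p * v i ^ p) + K ^ (p / 2) * (c n ^ p * v i ^ p) :=
        add_le_add (h1.trans h5) (h4.trans h3)
      _ = _ := by ring
  have hdiff : Tendsto (fun n => charFun (μ.map fun ω => c n * ∑ i ∈ range n, Y i ω) 1
      - ∏ i ∈ range n, ((Real.exp (-u n i) : ℝ) : ℂ)) atTop (𝓝 0) := by
    have h0 := hlyap.const_mul (4 * K + K ^ (p / 2))
    rw [mul_zero] at h0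
    refine squeeze_zero_norm (fun n => ?_) h0
    rw [hprod n]
    refine (norm_prod_sub_prod_le_sum _ _ _ (fun i _ => norm_charFun_le_one _) fun i _ => ?_).trans ?_
    · rw [Complex.norm_real, Real.norm_eq_abs, Real.abs_exp]
      exact Real.exp_le_one_iff.2 (neg_nonpos.2 (hu0 n i))
    · rw [mul_sum, mul_sum]
      exact sum_le_sum (hterm n)
  simpa using hdiff.add hgauss

end

/-- Jensen's inequality for an unnormalized weighted sum. -/
lemma abs_sum_mul_rpow_le {ι : Type*} (s : Finset ι) (w y : ι → ℝ) (hw : ∀ i ∈ s, 0 ≤ w i)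
    (hW : 0 < ∑ i ∈ s, w i) {p : ℝ} (hp : 1 ≤ p) :
    |∑ i ∈ s, w i * y i| ^ p ≤ (∑ i ∈ s, w i) ^ (p - 1) * ∑ i ∈ s, w i * |y i| ^ p := by
  set W := ∑ i ∈ s, w i with hWd
  have h1 := Real.rpow_arith_mean_le_arith_mean_rpow s (fun i => w i / W) (fun i => |y i|)
    (fun i hi => div_nonneg (hw i hi) hW.le) (by rw [← sum_div, ← hWd, div_self hW.ne'])
    (fun i _ => abs_nonneg _) hp
  have h2 : |∑ i ∈ s, w i * y i| ≤ W * ∑ i ∈ s, w i / W * |y i| := by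
    rw [mul_sum]
    refine (abs_sum_le_sum_abs _ _).trans (sum_le_sum fun i hi => ?_)
    rw [abs_mul, abs_of_nonneg (hw i hi), ← mul_assoc, mul_div_cancel₀ _ hW.ne']
  have h3 : 0 ≤ ∑ i ∈ s, w i / W * |y i| :=
    sum_nonneg fun i hi => mul_nonneg (div_nonneg (hw i hi) hW.le) (abs_nonneg _)
  calc |∑ i ∈ s, w i * y i| ^ p ≤ (W * ∑ i ∈ s, w i / W * |y i|) ^ p :=
        Real.rpow_le_rpow (abs_nonneg _) h2 (by linarith)
    _ = W ^ p * (∑ i ∈ s, w i / W * |y i|) ^ p := Real.mul_rpow hW.le h3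
    _ ≤ W ^ p * ∑ i ∈ s, w i / W * |y i| ^ p :=
        mul_le_mul_of_nonneg_left h1 (Real.rpow_nonneg hW.le _)
    _ = W ^ (p - 1) * ∑ i ∈ s, w i * |y i| ^ p := by
        rw [mul_sum, mul_sum]
        refine sum_congr rfl fun i _ => ?_
        rw [Real.rpow_sub_one hW.ne']
        field_simp

/-! ### Taylor estimates and symmetry for gradients -/

section Taylor

variable {E : Type*} [NormedAddCommGroup E] [InnerProductSpace ℝ E]

/-- Second order Taylor bound for a map whose second derivative is bounded on a ball. -/
lemma norm_sub_sub_fderiv_le {G : Type*} [NormedAddCommGroup G] [NormedSpace ℝ G] {g : E → G}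
    {θ : E} {δ C : ℝ} (h1 : ∀ a ∈ Metric.ball θ δ, DifferentiableAt ℝ g a)
    (h2 : ∀ a ∈ Metric.ball θ δ, DifferentiableAt ℝ (fderiv ℝ g) a)
    (hC : ∀ a ∈ Metric.ball θ δ, ‖fderiv ℝ (fderiv ℝ g) a‖ ≤ C) {a : E}
    (ha : a ∈ Metric.ball θ δ) :
    ‖g a - g θ - fderiv ℝ g θ (a - θ)‖ ≤ C * ‖a - θ‖ ^ 2 := by
  have hδ : 0 < δ := Metric.pos_of_mem_ball ha
  have hθ : θ ∈ Metric.ball θ δ := Metric.mem_ball_self hδ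
  have hC0 : 0 ≤ C := le_trans (by positivity) (hC θ hθ)
  have hsub : ∀ b ∈ Metric.closedBall θ ‖a - θ‖, b ∈ Metric.ball θ δ := by
    intro b hb
    rw [Metric.mem_closedBall] at hb
    rw [Metric.mem_ball, dist_eq_norm] at ha
    exact Metric.mem_ball.2 (hb.trans_lt ha)
  have hD : ∀ b ∈ Metric.closedBall θ ‖a - θ‖, ‖fderiv ℝ g b - fderiv ℝ g θ‖ ≤ C * ‖a - θ‖ := by
    intro b hb
    have := Convex.norm_image_sub_le_of_norm_fderiv_le h2 hC (convex_ball θ δ) hθ (hsub b hb)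
    refine this.trans (mul_le_mul_of_nonneg_left ?_ hC0)
    rwa [Metric.mem_closedBall, dist_eq_norm] at hb
  have := Convex.norm_image_sub_le_of_norm_fderiv_le' (fun b hb => h1 b (hsub b hb)) hD
    (convex_closedBall θ _) (Metric.mem_closedBall_self (norm_nonneg _))
    (show a ∈ Metric.closedBall θ ‖a - θ‖ by rw [Metric.mem_closedBall, dist_eq_norm])
  rwa [mul_assoc, ← sq] at this

variable [CompleteSpace E]

/-- Mean value inequality for `f` minus its linear part, the increment of the gradient being
controlled by the previous estimate. The constant involves the Jacobian only at `θ`; for `f = ρ(x,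
·)` it is therefore integrable in `x`, as centering the score requires. -/
lemma abs_sub_sub_inner_gradient_le {f : E → ℝ} {θ : E} {δ C : ℝ}
    (h0 : ∀ a ∈ Metric.ball θ δ, DifferentiableAt ℝ f a)
    (h1 : ∀ a ∈ Metric.ball θ δ, DifferentiableAt ℝ (gradient f) a)
    (h2 : ∀ a ∈ Metric.ball θ δ, DifferentiableAt ℝ (fderiv ℝ (gradient f)) a)
    (hC : ∀ a ∈ Metric.ball θ δ, ‖fderiv ℝ (fderiv ℝ (gradient f)) a‖ ≤ C) {a : E}
    (ha : a ∈ Metric.ball θ δ) :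
    |f a - f θ - inner ℝ (gradient f θ) (a - θ)|
      ≤ (‖fderiv ℝ (gradient f) θ‖ + C * δ) * ‖a - θ‖ ^ 2 := by
  have hδ : 0 < δ := Metric.pos_of_mem_ball ha
  have hθ : θ ∈ Metric.ball θ δ := Metric.mem_ball_self hδ
  have hC0 : 0 ≤ C := le_trans (by positivity) (hC θ hθ)
  have hsub : ∀ b ∈ Metric.closedBall θ ‖a - θ‖, b ∈ Metric.ball θ δ := by
    intro b hb
    rw [Metric.mem_closedBall] at hb
    rw [Metric.mem_ball, dist_eq_norm] at ha
    exact Metric.mem_ball.2 (hb.trans_lt ha)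
  have hD : ∀ b ∈ Metric.closedBall θ ‖a - θ‖,
      ‖fderiv ℝ f b - InnerProductSpace.toDual ℝ E (gradient f θ)‖
        ≤ (‖fderiv ℝ (gradient f) θ‖ + C * δ) * ‖a - θ‖ := by
    intro b hb
    have e : fderiv ℝ f b = InnerProductSpace.toDual ℝ E (gradient f b) := by simp [gradient]
    rw [e, ← map_sub, LinearIsometryEquiv.norm_map]
    have hb' : ‖b - θ‖ ≤ ‖a - θ‖ := by rwa [Metric.mem_closedBall, dist_eq_norm] at hb
    have hbδ : ‖b - θ‖ ≤ δ := by
      have := hsub b hb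
      rw [Metric.mem_ball, dist_eq_norm] at this
      exact this.le
    have h3 := norm_sub_sub_fderiv_le h1 h2 hC (hsub b hb)
    have h4 := (fderiv ℝ (gradient f) θ).le_opNorm (b - θ)
    have h5 : ‖gradient f b - gradient f θ‖
        ≤ ‖gradient f b - gradient f θ - fderiv ℝ (gradient f) θ (b - θ)‖
          + ‖fderiv ℝ (gradient f) θ (b - θ)‖ := norm_le_norm_sub_add _ _
    have h6 : C * ‖b - θ‖ ^ 2 ≤ C * δ * ‖b - θ‖ := by
      rw [sq, mul_assoc]
      exact mul_le_mul_of_nonneg_left (mul_le_mul_of_nonneg_right hbδ (norm_nonneg _)) hC0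
    have h7 : (‖fderiv ℝ (gradient f) θ‖ + C * δ) * ‖b - θ‖
        ≤ (‖fderiv ℝ (gradient f) θ‖ + C * δ) * ‖a - θ‖ :=
      mul_le_mul_of_nonneg_left hb' (by positivity)
    linarith
  have := Convex.norm_image_sub_le_of_norm_fderiv_le' (fun b hb => h0 b (hsub b hb)) hD
    (convex_closedBall θ _) (Metric.mem_closedBall_self (norm_nonneg _))
    (show a ∈ Metric.closedBall θ ‖a - θ‖ by rw [Metric.mem_closedBall, dist_eq_norm])
  rwa [mul_assoc, ← sq, InnerProductSpace.toDual_apply_apply, Real.norm_eq_abs] at this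

/-- The derivative of a gradient is symmetric. -/
lemma inner_fderiv_gradient_comm {f : E → ℝ} {θ : E} (h0 : ∀ᶠ a in 𝓝 θ, DifferentiableAt ℝ f a)
    (h1 : DifferentiableAt ℝ (gradient f) θ) (u v : E) :
    inner ℝ (fderiv ℝ (gradient f) θ u) v = inner ℝ (fderiv ℝ (gradient f) θ v) u := by
  have hd : HasFDerivAt (fderiv ℝ f)
      ((InnerProductSpace.toDual ℝ E).toContinuousLinearEquiv.toContinuousLinearMap ∘L
        fderiv ℝ (gradient f) θ) θ := by
    have h2 := ((InnerProductSpace.toDual ℝ E).toContinuousLinearEquiv.toContinuousLinearMap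
      ).hasFDerivAt.comp θ h1.hasFDerivAt
    refine h2.congr_of_eventuallyEq (Eventually.of_forall fun a => ?_)
    simp [gradient]
  have := second_derivative_symmetric_of_eventually (h0.mono fun a ha => ha.hasFDerivAt) hd u v
  simpa using this

end Taylor

/-! ### Norm bounds from coordinates -/

section Euclidean

variable {d : ℕ}

lemma euclidean_eq_sum_single (u : EuclideanSpace ℝ (Fin d)) :
    u = ∑ p, u p • EuclideanSpace.single p (1 : ℝ) := by
  ext k
  simp [Finset.sum_apply, Pi.single_apply]

lemma euclidean_norm_le_sum_abs (u : EuclideanSpace ℝ (Fin d)) : ‖u‖ ≤ ∑ p, |u p| := by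
  conv_lhs => rw [euclidean_eq_sum_single u]
  refine (norm_sum_le _ _).trans (sum_le_sum fun p _ => ?_)
  simp [norm_smul]

lemma euclidean_abs_apply_le_norm (u : EuclideanSpace ℝ (Fin d)) (p : Fin d) : |u p| ≤ ‖u‖ := by
  rw [← Real.norm_eq_abs]
  exact PiLp.norm_apply_le u p

lemma clm_apply_apply_eq_sum
    (T : EuclideanSpace ℝ (Fin d) →L[ℝ] EuclideanSpace ℝ (Fin d))
    (u : EuclideanSpace ℝ (Fin d)) (k : Fin d) :
    T u k = ∑ l, T (EuclideanSpace.single l 1) k * u l := by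
  conv_lhs => rw [euclidean_eq_sum_single u]
  simp [map_sum, mul_comm]

lemma norm_clm_le_sum (T : EuclideanSpace ℝ (Fin d) →L[ℝ] EuclideanSpace ℝ (Fin d)) :
    ‖T‖ ≤ ∑ k, ∑ l, |T (EuclideanSpace.single l 1) k| := by
  refine T.opNorm_le_bound (by positivity) fun u => (euclidean_norm_le_sum_abs _).trans ?_
  rw [sum_mul]
  refine sum_le_sum fun k _ => ?_
  rw [clm_apply_apply_eq_sum, sum_mul]
  refine (abs_sum_le_sum_abs _ _).trans (sum_le_sum fun l _ => ?_)
  rw [abs_mul]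
  exact mul_le_mul_of_nonneg_left (euclidean_abs_apply_le_norm u l) (abs_nonneg _)

/-- A bilinear map whose coordinates on the canonical basis are bounded is bounded. -/
lemma norm_clm₂_le (T : EuclideanSpace ℝ (Fin d) →L[ℝ] EuclideanSpace ℝ (Fin d) →L[ℝ]
    EuclideanSpace ℝ (Fin d)) {B : ℝ}
    (hB : ∀ k l p, |T (EuclideanSpace.single p 1) (EuclideanSpace.single l 1) k| ≤ B) :
    ‖T‖ ≤ (d : ℝ) ^ 3 * |B| := by
  refine T.opNorm_le_bound (by positivity) fun u => ?_
  have h1 : T u = ∑ p, u p • T (EuclideanSpace.single p 1) := by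
    conv_lhs => rw [euclidean_eq_sum_single u]
    simp only [map_sum, map_smul]
  have h2 : ∀ p, ‖T (EuclideanSpace.single p 1)‖ ≤ (d : ℝ) ^ 2 * |B| := by
    intro p
    refine (norm_clm_le_sum _).trans ?_
    refine (sum_le_sum fun k _ => sum_le_sum fun l _ => (hB k l p).trans (le_abs_self B)).trans ?_
    simp [sq, mul_assoc]
  rw [h1]
  refine (norm_sum_le _ _).trans ?_
  refine (sum_le_sum (g := fun _ => ‖u‖ * ((d : ℝ) ^ 2 * |B|)) fun p _ => ?_).trans ?_
  · rw [norm_smul, Real.norm_eq_abs]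
    exact mul_le_mul (euclidean_abs_apply_le_norm u p) (h2 p) (norm_nonneg _) (norm_nonneg _)
  · simp
    apply le_of_eq
    ring

end Euclidean

/-! ### Uniform convergence and consistency of minimizers -/

section Argmin

/-- All nets come from one countable set, so that almost sure convergence at its points excludes a
single null set. -/
lemma exists_countable_nets {E : Type*} [PseudoMetricSpace E] {Θ : Set E}
    (hΘ : TotallyBounded Θ) :
    ∃ D ⊆ Θ, D.Countable ∧ ∀ δ > 0, ∃ t ⊆ D, t.Finite ∧ ∀ a ∈ Θ, ∃ b ∈ t, dist a b < δ := by
  have h : ∀ q : ℕ, ∃ t ⊆ Θ, t.Finite ∧ ∀ a ∈ Θ, ∃ b ∈ t, dist a b < 1 / ((q : ℝ) + 1) := by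
    intro q
    obtain ⟨t, ht, hf, hc⟩ := totallyBounded_iff_subset.1 hΘ _
      (Metric.dist_mem_uniformity (ε := 1 / ((q : ℝ) + 1)) (by positivity))
    refine ⟨t, ht, hf, fun a ha => ?_⟩
    have := hc ha
    simpa using this
  choose t ht hf hc using h
  refine ⟨⋃ q, t q, Set.iUnion_subset ht, Set.countable_iUnion fun q => (hf q).countable, ?_⟩
  intro δ hδ
  obtain ⟨q, hq⟩ := exists_nat_one_div_lt hδ
  refine ⟨t q, Set.subset_iUnion t q, hf q, fun a ha => ?_⟩
  obtain ⟨b, hb, hab⟩ := hc q a ha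
  exact ⟨b, hb, hab.trans hq⟩

variable {E : Type*} [NormedAddCommGroup E]

/-- Pointwise convergence on finite nets and a common Hölder bound give uniform convergence. -/
lemma tendstoUniformlyOn_of_holder {Θ D : Set E} {M : ℕ → E → ℝ} {M' : E → ℝ} {K : ℕ → ℝ}
    {K' r : ℝ} (hr : 0 < r) (hDΘ : D ⊆ Θ)
    (hD : ∀ δ > 0, ∃ t ⊆ D, t.Finite ∧ ∀ a ∈ Θ, ∃ b ∈ t, dist a b < δ)
    (hM : ∀ n, ∀ a ∈ Θ, ∀ b ∈ Θ, |M n a - M n b| ≤ K n * ‖a - b‖ ^ r)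
    (hM' : ∀ a ∈ Θ, ∀ b ∈ Θ, |M' a - M' b| ≤ K' * ‖a - b‖ ^ r) (hK' : 0 ≤ K')
    (hK : Tendsto K atTop (𝓝 K')) (hlim : ∀ a ∈ D, Tendsto (fun n => M n a) atTop (𝓝 (M' a))) :
    TendstoUniformlyOn M M' atTop Θ := by
  rw [Metric.tendstoUniformlyOn_iff]
  intro ε hε
  -- `K' + 1` dominates both Hölder constants for large `n`, so moving to a net point costs `ε / 3`
  -- in each criterion; the last third is the pointwise error on the finite net.
  obtain ⟨δ, hδ, hδε⟩ : ∃ δ > 0, (K' + 1) * δ ^ r < ε / 3 := by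
    have h1 : Tendsto (fun δ : ℝ => (K' + 1) * δ ^ r) (𝓝[>] 0) (𝓝 ((K' + 1) * 0 ^ r)) :=
      ((Real.continuousAt_rpow_const 0 r (Or.inr hr.le)).tendsto.mono_left
        nhdsWithin_le_nhds).const_mul _
    rw [Real.zero_rpow hr.ne', mul_zero] at h1
    have h2 := (h1.eventually (gt_mem_nhds (show (0 : ℝ) < ε / 3 by linarith))).and
      self_mem_nhdsWithin
    obtain ⟨δ, h3, h4⟩ := h2.exists
    exact ⟨δ, h4, h3⟩
  obtain ⟨t, htD, htf, ht⟩ := hD δ hδ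
  have e1 : ∀ᶠ n in atTop, ∀ b ∈ t, |M n b - M' b| < ε / 3 := by
    rw [eventually_all_finite htf]
    intro b hb
    have := (Metric.tendsto_nhds.1 (hlim b (htD hb))) (ε / 3) (by linarith)
    simpa [Real.dist_eq] using this
  have e2 : ∀ᶠ n in atTop, K n < K' + 1 := hK.eventually (gt_mem_nhds (by linarith))
  filter_upwards [e1, e2] with n h1 h2 a ha
  obtain ⟨b, hb, hab⟩ := ht a ha
  have hbΘ := hDΘ (htD hb)
  rw [dist_eq_norm] at hab
  have h3 : ‖a - b‖ ^ r ≤ δ ^ r := Real.rpow_le_rpow (norm_nonneg _) hab.le hr.le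
  have h0 : 0 ≤ ‖a - b‖ ^ r := Real.rpow_nonneg (norm_nonneg _) _
  have h4 := abs_le.1 (hM n a ha b hbΘ)
  have h5 := abs_le.1 (hM' a ha b hbΘ)
  have h6 := abs_lt.1 (h1 b hb)
  have h7 : K n * ‖a - b‖ ^ r < ε / 3 := by nlinarith
  have h8 : K' * ‖a - b‖ ^ r < ε / 3 := by nlinarith
  rw [Real.dist_eq, abs_lt]
  constructor <;> linarith

/-- Minimizers of uniformly converging criteria converge to a well-separated minimizer. -/
lemma tendsto_of_isMinOn {Θ : Set E} {θ : E} (hθ : θ ∈ Θ) {M : ℕ → E → ℝ} {M' : E → ℝ}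
    (hM : TendstoUniformlyOn M M' atTop Θ)
    (hsep : ∀ ε > 0, ∃ c > M' θ, ∀ a ∈ Θ, ε < ‖a - θ‖ → c ≤ M' a) {a : ℕ → E}
    (ha : ∀ᶠ n in atTop, a n ∈ Θ ∧ IsMinOn (M n) Θ (a n)) : Tendsto a atTop (𝓝 θ) := by
  rw [Metric.tendsto_nhds]
  intro ε hε
  -- Negating convergence gives only `ε ≤ ‖a n - θ‖`, while the separation needs a strict
  -- inequality; hence `ε / 2`.
  obtain ⟨c, hc, hsep⟩ := hsep (ε / 2) (by linarith)
  filter_upwards [ha, (Metric.tendstoUniformlyOn_iff.1 hM) ((c - M' θ) / 2) (by linarith)]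
    with n ⟨h1, h2⟩ h3
  by_contra hcon
  rw [dist_eq_norm] at hcon
  have h4 := hsep (a n) h1 (by linarith)
  have h5 := abs_lt.1 (Real.dist_eq _ _ ▸ h3 (a n) h1)
  have h6 := abs_lt.1 (Real.dist_eq _ _ ▸ h3 θ hθ)
  have h7 : M n (a n) ≤ M n θ := h2 hθ
  linarith

end Argmin

/-! ### Law of large numbers for weighted clusters -/

/-- Variables with summable variances and converging means converge almost surely. -/
lemma ae_tendsto_of_summable_variance {Ω : Type*} [MeasurableSpace Ω] {μ : Measure Ω}
    [IsProbabilityMeasure μ] {Y : ℕ → Ω → ℝ} (hY : ∀ k, MemLp (Y k) 2 μ) {b : ℕ → ℝ}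
    (hb : Summable b) (hYb : ∀ k, Var[Y k; μ] ≤ b k) {c : ℝ}
    (hc : Tendsto (fun k => ∫ ω, Y k ω ∂μ) atTop (𝓝 c)) :
    ∀ᵐ ω ∂μ, Tendsto (fun k => Y k ω) atTop (𝓝 c) := by
  have hm : ∀ k, AEMeasurable (fun ω => ENNReal.ofReal ((Y k ω - ∫ x, Y k x ∂μ) ^ 2)) μ := fun k =>
    (((hY k).aemeasurable.sub_const _).pow_const 2).ennreal_ofReal
  -- The series of squared deviations has finite expectation, so it converges almost surely and its
  -- terms tend to `0`.
  have h1 : ∫⁻ ω, ∑' k, ENNReal.ofReal ((Y k ω - ∫ x, Y k x ∂μ) ^ 2) ∂μ ≠ ⊤ := by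
    rw [lintegral_tsum hm]
    have hb0 : ∀ k, 0 ≤ b k := fun k => (variance_nonneg _ _).trans (hYb k)
    have h2 : ∀ k, ∫⁻ ω, ENNReal.ofReal ((Y k ω - ∫ x, Y k x ∂μ) ^ 2) ∂μ ≤ ENNReal.ofReal (b k) := by
      intro k
      rw [← evariance_eq_lintegral_ofReal, ← (hY k).ofReal_variance_eq]
      exact ENNReal.ofReal_le_ofReal (hYb k)
    refine ((ENNReal.tsum_le_tsum h2).trans_lt ?_).ne
    rw [← ENNReal.ofReal_tsum_of_nonneg hb0 hb]
    exact ENNReal.ofReal_lt_top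
  filter_upwards [ae_lt_top' (AEMeasurable.tsum hm) h1] with ω hω
  have h3 := ENNReal.tendsto_atTop_zero_of_tsum_ne_top hω.ne
  have h4 : Tendsto (fun k => (Y k ω - ∫ x, Y k x ∂μ) ^ 2) atTop (𝓝 0) := by
    have := (ENNReal.tendsto_toReal ENNReal.zero_ne_top).comp h3
    simpa [Function.comp_def, ENNReal.toReal_ofReal, sq_nonneg] using this
  have h5 : Tendsto (fun k => Y k ω - ∫ x, Y k x ∂μ) atTop (𝓝 0) := by
    have := (Real.continuous_sqrt.tendsto 0).comp h4
    simp only [Function.comp_def, Real.sqrt_sq_eq_abs, Real.sqrt_zero] at this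
    exact (tendsto_zero_iff_abs_tendsto_zero _).2 this
  simpa using h5.add hc

section Clusters

variable {Ω 𝒳 : Type*} {m : ℕ → ℕ} (w : (i : ℕ) → Fin (m i) → ℝ) (X : (i : ℕ) → Fin (m i) → Ω → 𝒳)

/-- The weighted sum of `f` over the cluster `i`. -/
def clusterSum (f : 𝒳 → ℝ) (i : ℕ) (ω : Ω) : ℝ := ∑ j, w i j * f (X i j ω)

/-- The weighted empirical mean of `f` over the first `n` clusters. -/
def weightedMean (f : 𝒳 → ℝ) (n : ℕ) (ω : Ω) : ℝ :=
  (1 / (totalSize m n : ℝ)) * ∑ i ∈ range n, clusterSum w X f i ω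

lemma weightedMean_const_mul (c : ℝ) (f : 𝒳 → ℝ) (n : ℕ) (ω : Ω) :
    weightedMean w X (fun x => c * f x) n ω = c * weightedMean w X f n ω := by
  simp only [weightedMean, clusterSum, mul_sum]
  refine sum_congr rfl fun i _ => sum_congr rfl fun j _ => by ring

lemma weightedMean_sub (f g : 𝒳 → ℝ) (n : ℕ) (ω : Ω) :
    weightedMean w X (fun x => f x - g x) n ω = weightedMean w X f n ω - weightedMean w X g n ω := by
  simp only [weightedMean, clusterSum, mul_sub, sum_sub_distrib]

lemma weightedMean_sum {ι : Type*} (s : Finset ι) (f : ι → 𝒳 → ℝ) (n : ℕ) (ω : Ω) :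
    weightedMean w X (fun x => ∑ l ∈ s, f l x) n ω = ∑ l ∈ s, weightedMean w X (f l) n ω := by
  simp only [weightedMean, clusterSum, mul_sum]
  rw [sum_comm]
  exact sum_congr rfl fun i _ => sum_comm

variable {w}

lemma abs_weightedMean_le (hw : ∀ i j, 0 < w i j) {f g : 𝒳 → ℝ} (hfg : ∀ x, |f x| ≤ g x) (n : ℕ)
    (ω : Ω) : |weightedMean w X f n ω| ≤ weightedMean w X g n ω := by
  have h0 : (0 : ℝ) ≤ 1 / (totalSize m n : ℝ) := by positivity
  simp only [weightedMean, clusterSum]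
  rw [abs_mul, abs_of_nonneg h0]
  refine mul_le_mul_of_nonneg_left ((abs_sum_le_sum_abs _ _).trans (sum_le_sum fun i _ =>
    (abs_sum_le_sum_abs _ _).trans (sum_le_sum fun j _ => ?_))) h0
  rw [abs_mul, abs_of_pos (hw i j)]
  exact mul_le_mul_of_nonneg_left (hfg _) (hw i j).le

lemma sum_weights_pos (hm : ∀ i, 1 ≤ m i) (hw : ∀ i j, 0 < w i j) (i : ℕ) : 0 < ∑ j, w i j :=
  sum_pos (fun j _ => hw i j) ⟨⟨0, hm i⟩, mem_univ _⟩

lemma le_totalSize (hm : ∀ i, 1 ≤ m i) (n : ℕ) : n ≤ totalSize m n := by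
  have := card_nsmul_le_sum (range n) m 1 fun i _ => hm i
  simpa [totalSize] using this

variable [MeasurableSpace Ω] [MeasurableSpace 𝒳] {X} {μ : Measure Ω} [IsProbabilityMeasure μ] {P : Measure 𝒳}
  (hXmeas : ∀ i j, Measurable (X i j)) (hXlaw : ∀ i j, μ.map (X i j) = P)

include hXmeas hXlaw

omit [IsProbabilityMeasure μ] in
lemma integrable_comp_obs {f : 𝒳 → ℝ} (hf : Integrable f P) (i : ℕ) (j : Fin (m i)) :
    Integrable (fun ω => f (X i j ω)) μ := by
  rw [← hXlaw i j] at hf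
  exact hf.comp_measurable (hXmeas i j)

omit [IsProbabilityMeasure μ] in
lemma memLp_comp_obs {f : 𝒳 → ℝ} (hf : MemLp f 2 P) (i : ℕ) (j : Fin (m i)) :
    MemLp (fun ω => f (X i j ω)) 2 μ := by
  rw [← hXlaw i j] at hf
  exact hf.comp_of_map (hXmeas i j).aemeasurable

omit [IsProbabilityMeasure μ] in
lemma integral_comp_obs {f : 𝒳 → ℝ} (hf : AEStronglyMeasurable f P) (i : ℕ) (j : Fin (m i)) :
    ∫ ω, f (X i j ω) ∂μ = ∫ x, f x ∂P := by
  rw [← hXlaw i j] at hf ⊢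
  exact (integral_map (hXmeas i j).aemeasurable hf).symm

omit [IsProbabilityMeasure μ] in
lemma memLp_clusterSum {f : 𝒳 → ℝ} (hf : MemLp f 2 P) (i : ℕ) :
    MemLp (clusterSum w X f i) 2 μ :=
  memLp_finsetSum _ fun j _ => (memLp_comp_obs hXmeas hXlaw hf i j).const_mul (w i j)

omit [IsProbabilityMeasure μ] in
lemma integral_clusterSum {f : 𝒳 → ℝ} (hf : Integrable f P) (i : ℕ) :
    ∫ ω, clusterSum w X f i ω ∂μ = (∑ j, w i j) * ∫ x, f x ∂P := by
  simp only [clusterSum]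
  rw [integral_finsetSum _ fun j _ => (integrable_comp_obs hXmeas hXlaw hf i j).const_mul _, sum_mul]
  refine sum_congr rfl fun j _ => ?_
  rw [integral_const_mul, integral_comp_obs hXmeas hXlaw hf.aestronglyMeasurable]

omit [IsProbabilityMeasure μ] in
/-- The moments of a weighted cluster sum are at most those of a single variable with the total
weight. -/
lemma integral_abs_clusterSum_rpow_le (hm : ∀ i, 1 ≤ m i) (hw : ∀ i j, 0 < w i j) {f : 𝒳 → ℝ}
    (hfm : AEStronglyMeasurable f P) {p : ℝ} (hp : 1 ≤ p) (hf : Integrable (fun x => |f x| ^ p) P)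
    (i : ℕ) :
    Integrable (fun ω => |clusterSum w X f i ω| ^ p) μ ∧
      ∫ ω, |clusterSum w X f i ω| ^ p ∂μ ≤ (∑ j, w i j) ^ p * ∫ x, |f x| ^ p ∂P := by
  have hW := sum_weights_pos hm hw i
  have hi : Integrable (fun ω => (∑ j, w i j) ^ (p - 1) * ∑ j, w i j * |f (X i j ω)| ^ p) μ :=
    (integrable_finsetSum _ fun j _ =>
      (integrable_comp_obs hXmeas hXlaw hf i j).const_mul _).const_mul _
  have hle : ∀ ω, |clusterSum w X f i ω| ^ p
      ≤ (∑ j, w i j) ^ (p - 1) * ∑ j, w i j * |f (X i j ω)| ^ p := fun ω =>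
    abs_sum_mul_rpow_le univ (w i) (fun j => f (X i j ω)) (fun j _ => (hw i j).le) hW hp
  have hmeas : AEMeasurable (clusterSum w X f i) μ := by
    refine Finset.aemeasurable_fun_sum _ fun j _ => AEMeasurable.const_mul ?_ _
    have : AEStronglyMeasurable f (μ.map (X i j)) := by rwa [hXlaw i j]
    exact (this.comp_measurable (hXmeas i j)).aemeasurable
  have hint : Integrable (fun ω => |clusterSum w X f i ω| ^ p) μ := by
    refine hi.mono' (hmeas.abs.pow_const p).aestronglyMeasurable (ae_of_all _ fun ω => ?_)
    rw [Real.norm_eq_abs, abs_of_nonneg (Real.rpow_nonneg (abs_nonneg _) _)]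
    exact hle ω
  refine ⟨hint, (integral_mono hint hi hle).trans (le_of_eq ?_)⟩
  rw [integral_const_mul, integral_finsetSum _ fun j _ =>
      (integrable_comp_obs hXmeas hXlaw hf i j).const_mul _]
  have : ∀ j ∈ univ, ∫ ω, w i j * |f (X i j ω)| ^ p ∂μ = w i j * ∫ x, |f x| ^ p ∂P := fun j _ => by
    rw [integral_const_mul, integral_comp_obs hXmeas hXlaw hf.aestronglyMeasurable]
  rw [sum_congr rfl this, ← sum_mul, ← mul_assoc, Real.rpow_sub_one hW.ne', div_mul_cancel₀ _ hW.ne']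

omit [IsProbabilityMeasure μ] in
lemma integral_clusterSum_sq_le (hm : ∀ i, 1 ≤ m i) (hw : ∀ i j, 0 < w i j) {f : 𝒳 → ℝ}
    (hf : MemLp f 2 P) (i : ℕ) :
    ∫ ω, clusterSum w X f i ω ^ 2 ∂μ ≤ (∑ j, w i j) ^ 2 * ∫ x, f x ^ 2 ∂P := by
  have h := (integral_abs_clusterSum_rpow_le hXmeas hXlaw hm hw hf.aestronglyMeasurable
    (p := 2) (by norm_num) (by simpa using hf.integrable_sq) i).2
  simpa using h

omit hXmeas hXlaw [IsProbabilityMeasure μ] in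
lemma iIndepFun_clusterSum
    (hXindep : iIndepFun (fun (i : ℕ) (ω : Ω) (j : Fin (m i)) => X i j ω) μ) {f : 𝒳 → ℝ}
    (hf : Measurable f) : iIndepFun (clusterSum w X f) μ :=
  hXindep.comp (fun i x => ∑ j, w i j * f (x j)) fun i => by fun_prop

/-- Independence is used only between clusters: each cluster counts as one observation carrying its
total weight. -/
lemma variance_weightedMean_le (hm : ∀ i, 1 ≤ m i) (hw : ∀ i j, 0 < w i j)
    (hXindep : iIndepFun (fun (i : ℕ) (ω : Ω) (j : Fin (m i)) => X i j ω) μ) {f : 𝒳 → ℝ}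
    (hfm : Measurable f) (hf : MemLp f 2 P) (n : ℕ) :
    Var[weightedMean w X f n; μ] ≤ (1 / (totalSize m n : ℝ)) ^ 2 *
      ∑ i ∈ range n, (∑ j, w i j) ^ 2 * ∫ x, f x ^ 2 ∂P := by
  have h2 := fun i => memLp_clusterSum (w := w) hXmeas hXlaw hf i
  have hind := iIndepFun_clusterSum (w := w) hXindep hfm
  have e : weightedMean w X f n = fun ω => (1 / (totalSize m n : ℝ)) *
      (∑ i ∈ range n, clusterSum w X f i) ω := by
    ext ω
    simp [weightedMean]
  rw [e, variance_const_mul, IndepFun.variance_sum (fun i _ => h2 i)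
    fun i _ j _ hij => hind.indepFun hij]
  refine mul_le_mul_of_nonneg_left (sum_le_sum fun i _ => ?_) (sq_nonneg _)
  refine (variance_le_expectation_sq (h2 i).aestronglyMeasurable).trans ?_
  simpa using integral_clusterSum_sq_le hXmeas hXlaw hm hw hf i

/-- **Weighted law of large numbers** along sparse subsequences. -/
theorem ae_tendsto_weightedMean (hm : ∀ i, 1 ≤ m i) (hw : ∀ i j, 0 < w i j)
    (hXindep : iIndepFun (fun (i : ℕ) (ω : Ω) (j : Fin (m i)) => X i j ω) μ)
    (hw1 : Tendsto (fun n : ℕ => (1 / (totalSize m n : ℝ)) * ∑ i ∈ range n, ∑ j, w i j)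
      atTop (𝓝 1)) {B : ℝ}
    (hB : ∀ n, (1 / (totalSize m n : ℝ)) * ∑ i ∈ range n, (∑ j, w i j) ^ 2 ≤ B) {f : 𝒳 → ℝ}
    (hf : MemLp f 2 P) {φ : ℕ → ℕ} (hφ : ∀ k, (k + 1) ^ 2 ≤ φ k) :
    ∀ᵐ ω ∂μ, Tendsto (fun k => weightedMean w X f (φ k) ω) atTop (𝓝 (∫ x, f x ∂P)) := by
  have hprob : IsProbabilityMeasure P := hXlaw 0 ⟨0, hm 0⟩ ▸
    Measure.isProbabilityMeasure_map (hXmeas _ _).aemeasurable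
  -- Independence of cluster sums passes through a measurable function, whereas `f` is only almost
  -- everywhere measurable; the two agree at all the countably many observations, almost surely.
  set g := hf.aestronglyMeasurable.mk f with hg
  have hfg : f =ᵐ[P] g := hf.aestronglyMeasurable.ae_eq_mk
  have hgm : Measurable g := hf.aestronglyMeasurable.stronglyMeasurable_mk.measurable
  have hg2 : MemLp g 2 P := hf.ae_eq hfg
  have hφt : Tendsto φ atTop atTop := tendsto_atTop_mono (fun k => by
    have := hφ k
    show k ≤ φ k
    nlinarith) tendsto_id
  have key : ∀ᵐ ω ∂μ, Tendsto (fun k => weightedMean w X g (φ k) ω) atTop (𝓝 (∫ x, g x ∂P)) := by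
    have hJ : 0 ≤ ∫ x, g x ^ 2 ∂P := integral_nonneg fun x => sq_nonneg _
    have hB0 : 0 ≤ B := le_trans (by positivity) (hB 0)
    -- The variance is at most `B * ∫ g² / N`, and `N ≥ φ k ≥ (k + 1)²`; the sparsity of `φ` is what
    -- makes this summable.
    refine ae_tendsto_of_summable_variance (b := fun k => B * (∫ x, g x ^ 2 ∂P) * (1 / ((k : ℝ) + 1) ^ 2))
      (fun k => ?_) ?_ (fun k => ?_) ?_
    · exact (memLp_finsetSum _ fun i _ => memLp_clusterSum hXmeas hXlaw hg2 i).const_mul _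
    · have := (summable_nat_add_iff 1).2 (Real.summable_one_div_nat_pow.2 one_lt_two)
      exact Summable.mul_left _ (by simpa using this)
    · refine (variance_weightedMean_le hXmeas hXlaw hm hw hXindep hgm hg2 (φ k)).trans ?_
      have hN : ((k : ℝ) + 1) ^ 2 ≤ (totalSize m (φ k) : ℝ) := by
        exact_mod_cast (hφ k).trans (le_totalSize hm _)
      have hk : (0 : ℝ) < ((k : ℝ) + 1) ^ 2 := by positivity
      have hinv : 1 / (totalSize m (φ k) : ℝ) ≤ 1 / ((k : ℝ) + 1) ^ 2 :=
        one_div_le_one_div_of_le hk hN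
      have h0 : 0 ≤ 1 / (totalSize m (φ k) : ℝ) := by positivity
      rw [← sum_mul, sq (1 / (totalSize m (φ k) : ℝ))]
      calc _ = (1 / (totalSize m (φ k) : ℝ) * ∑ i ∈ range (φ k), (∑ j, w i j) ^ 2)
              * (∫ x, g x ^ 2 ∂P) * (1 / (totalSize m (φ k) : ℝ)) := by ring
        _ ≤ _ := mul_le_mul (mul_le_mul_of_nonneg_right (hB _) hJ) hinv h0 (mul_nonneg hB0 hJ)
    · have hgi : Integrable g P := hg2.integrable (by norm_num)
      have h1 := ((hw1.comp hφt).mul_const (∫ x, g x ∂P))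
      rw [one_mul] at h1
      refine h1.congr fun k => ?_
      simp only [Function.comp_apply, weightedMean]
      rw [integral_const_mul, integral_finsetSum _ fun i _ =>
        (memLp_clusterSum hXmeas hXlaw hg2 i).integrable (by norm_num), mul_assoc, sum_mul]
      congr 1
      exact sum_congr rfl fun i _ => (integral_clusterSum hXmeas hXlaw hgi i).symm
  have hall : ∀ᵐ ω ∂μ, ∀ i, ∀ j : Fin (m i), f (X i j ω) = g (X i j ω) := by
    rw [ae_all_iff]
    intro i
    rw [ae_all_iff]
    intro j
    refine ae_of_ae_map (hXmeas i j).aemeasurable (p := fun x => f x = g x) ?_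
    rw [hXlaw i j]
    exact hfg
  filter_upwards [key, hall] with ω h1 h2
  rw [integral_congr_ae hfg]
  refine h1.congr fun k => ?_
  simp only [weightedMean, clusterSum, h2]

end Clusters

/-! ### Bounds on powers and a criterion for a zero slope -/

lemma rpow_le_one_add_rpow {x q p : ℝ} (hx : 0 ≤ x) (hq : 0 ≤ q) (hqp : q ≤ p) :
    x ^ q ≤ 1 + x ^ p := by
  rcases le_or_gt x 1 with h | h
  · have := Real.rpow_le_one hx h hq
    have := Real.rpow_nonneg hx p
    linarith
  · have := Real.rpow_le_rpow_of_exponent_le h.le hqp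
    linarith

/-- A bounded weighted mean of `v i ^ p` bounds the weighted means of all smaller powers. -/
lemma exists_bound_mean_rpow {m : ℕ → ℕ} (hm : ∀ i, 1 ≤ m i) {v : ℕ → ℝ} (hv : ∀ i, 0 ≤ v i)
    {p L : ℝ} (hL : Tendsto (fun n : ℕ => (1 / (totalSize m n : ℝ)) * ∑ i ∈ range n, v i ^ p)
      atTop (𝓝 L)) :
    ∃ B, ∀ q, 0 ≤ q → q ≤ p → ∀ n,
      (1 / (totalSize m n : ℝ)) * ∑ i ∈ range n, v i ^ q ≤ B := by
  obtain ⟨B, hB⟩ := hL.bddAbove_range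
  refine ⟨1 + B, fun q hq hqp n => ?_⟩
  have h0 : (0 : ℝ) ≤ 1 / (totalSize m n : ℝ) := by positivity
  have h1 := hB ⟨n, rfl⟩
  have h2 : ∑ i ∈ range n, v i ^ q ≤ n + ∑ i ∈ range n, v i ^ p := by
    refine (sum_le_sum fun i _ => rpow_le_one_add_rpow (hv i) hq hqp).trans (le_of_eq ?_)
    rw [sum_add_distrib]
    simp
  have h3 : 1 / (totalSize m n : ℝ) * n ≤ 1 := by
    have : (n : ℝ) ≤ totalSize m n := by exact_mod_cast le_totalSize hm n
    rw [one_div_mul_eq_div]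
    exact div_le_one_of_le₀ this (by positivity)
  have h4 := mul_le_mul_of_nonneg_left h2 h0
  rw [mul_add] at h4
  simp only at h1
  linarith

/-- A quadratic bound from below by `0` near `0` forces the linear coefficient to vanish. -/
lemma eq_zero_of_forall_nonneg_quadratic {δ a Q : ℝ} (hδ : 0 < δ)
    (h : ∀ t, |t| < δ → 0 ≤ t * a + Q * t ^ 2) : a = 0 := by
  have hd : HasDerivAt (fun t : ℝ => t * a + Q * t ^ 2) a 0 := by
    have := ((hasDerivAt_id' (0 : ℝ)).mul_const a).fun_add
      (((hasDerivAt_id' (0 : ℝ)).fun_pow 2).const_mul Q)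
    simpa using this
  refine IsLocalMin.hasDerivAt_eq_zero ?_ hd
  filter_upwards [Metric.ball_mem_nhds (0 : ℝ) hδ] with t ht
  simpa using h t (by simpa using ht)

/-! ### Measurability, moments and centering of the score -/

section Score

variable {d : ℕ} {P : Measure (EuclideanSpace ℝ (Fin d))}
  {Θ : Set (EuclideanSpace ℝ (Fin d))} {θ : EuclideanSpace ℝ (Fin d)}
  {ρ : EuclideanSpace ℝ (Fin d) → EuclideanSpace ℝ (Fin d) → ℝ}

/-- The score `⟪u, ψ(·, θ)⟫` is a pointwise limit of difference quotients of `ρ`. -/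
lemma measurable_inner_psi (hθ : θ ∈ interior Θ) (hρmeas : ∀ a ∈ Θ, Measurable (fun x => ρ x a))
    (hdiff : ∀ x, DifferentiableAt ℝ (ρ x) θ) (u : EuclideanSpace ℝ (Fin d)) :
    Measurable fun x => inner ℝ u (psi ρ x θ) := by
  classical
  have hΘ : Θ ∈ 𝓝 θ := mem_interior_iff_mem_nhds.1 hθ
  set t : ℕ → ℝ := fun n => 1 / ((n : ℝ) + 1) with ht
  have htend : Tendsto t atTop (𝓝 0) := tendsto_one_div_add_atTop_nhds_zero_nat
  have ht0 : ∀ n, t n ≠ 0 := fun n => (by positivity : (0 : ℝ) < t n).ne'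
  have hpath : Tendsto (fun s : ℝ => θ + s • u) (𝓝 0) (𝓝 θ) := by
    have : Continuous fun s : ℝ => θ + s • u := by fun_prop
    simpa using this.tendsto 0
  -- Measurability of `ρ(·, a)` is known only for `a ∈ Θ`; the quotients are set to `0` outside,
  -- which does not affect the limit since `θ` is interior.
  refine measurable_of_tendsto_metrizable
    (f := fun n x => if θ + t n • u ∈ Θ then (t n)⁻¹ • (ρ x (θ + t n • u) - ρ x θ) else 0)
    (fun n => ?_) (tendsto_pi_nhds.2 fun x => ?_)
  · by_cases h : θ + t n • u ∈ Θ
    · simp only [h, if_true]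
      exact ((hρmeas _ h).sub (hρmeas θ (interior_subset hθ))).const_mul (t n)⁻¹
    · simp [h]
  · have h1 : HasDerivAt (fun s : ℝ => ρ x (θ + s • u)) (inner ℝ u (psi ρ x θ)) 0 := by
      have h2 : HasDerivAt (fun s : ℝ => θ + s • u) u 0 := by
        simpa using ((hasDerivAt_id (0 : ℝ)).smul_const u).const_add θ
      have h3 : HasFDerivAt (ρ x) (fderiv ℝ (ρ x) θ) (θ + (0 : ℝ) • u) := by
        simpa using (hdiff x).hasFDerivAt
      have h4 := h3.comp_hasDerivAt 0 h2
      have h5 : fderiv ℝ (ρ x) θ u = inner ℝ u (psi ρ x θ) := by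
        rw [real_inner_comm, psi, gradient, ← InnerProductSpace.toDual_apply_apply,
          LinearIsometryEquiv.apply_symm_apply]
      rwa [h5] at h4
    have h6 := h1.tendsto_slope_zero.comp (tendsto_nhdsWithin_iff.2 ⟨htend,
      Eventually.of_forall fun n => ht0 n⟩)
    refine h6.congr' ?_
    filter_upwards [htend.eventually (hpath hΘ)] with n hn
    have hn' : θ + t n • u ∈ Θ := hn
    simp [hn']

lemma integrable_abs_inner_psi_rpow (hmeas : ∀ u, Measurable fun x => inner ℝ u (psi ρ x θ))
    [IsProbabilityMeasure P] {p q : ℝ} (hq : 0 ≤ q) (hqp : q ≤ p)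
    (hp : Integrable (fun x => ‖psi ρ x θ‖ ^ p) P) (u : EuclideanSpace ℝ (Fin d)) :
    Integrable (fun x => |inner ℝ u (psi ρ x θ)| ^ q) P := by
  refine (((integrable_const (1 : ℝ)).add hp).const_mul (‖u‖ ^ q)).mono'
    ((hmeas u).abs.pow_const q).aestronglyMeasurable (ae_of_all _ fun x => ?_)
  rw [Real.norm_eq_abs, abs_of_nonneg (Real.rpow_nonneg (abs_nonneg _) _)]
  calc |inner ℝ u (psi ρ x θ)| ^ q ≤ (‖u‖ * ‖psi ρ x θ‖) ^ q :=
        Real.rpow_le_rpow (abs_nonneg _) (abs_real_inner_le_norm _ _) hq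
    _ = ‖u‖ ^ q * ‖psi ρ x θ‖ ^ q := Real.mul_rpow (norm_nonneg _) (norm_nonneg _)
    _ ≤ _ := mul_le_mul_of_nonneg_left (rpow_le_one_add_rpow (norm_nonneg _) hq hqp)
        (Real.rpow_nonneg (norm_nonneg _) _)

lemma memLp_inner_psi (hmeas : ∀ u, Measurable fun x => inner ℝ u (psi ρ x θ))
    [IsProbabilityMeasure P] {p : ℝ} (hp2 : 2 ≤ p)
    (hp : Integrable (fun x => ‖psi ρ x θ‖ ^ p) P) (u : EuclideanSpace ℝ (Fin d)) :
    MemLp (fun x => inner ℝ u (psi ρ x θ)) 2 P := by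
  rw [memLp_two_iff_integrable_sq (hmeas u).aestronglyMeasurable]
  simpa using integrable_abs_inner_psi_rpow hmeas (by norm_num) hp2 hp u

lemma psi_apply_eq_inner (x a : EuclideanSpace ℝ (Fin d)) (k : Fin d) :
    psi ρ x a k = inner ℝ (EuclideanSpace.single k (1 : ℝ)) (psi ρ x a) := by
  rw [EuclideanSpace.inner_single_left]
  simp

/-- The separation condition, with an explicit real threshold. -/
lemma exists_risk_gap (hA1a : ∀ ε > 0, ((risk P ρ θ : ℝ) : EReal) <
      ⨅ a ∈ {a ∈ Θ | ε < ‖a - θ‖}, ((risk P ρ a : ℝ) : EReal)) :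
    ∀ ε > 0, ∃ c > risk P ρ θ, ∀ a ∈ Θ, ε < ‖a - θ‖ → c ≤ risk P ρ a := by
  intro ε hε
  obtain ⟨c, hc1, hc2⟩ := EReal.lt_iff_exists_real_btwn.1 (hA1a ε hε)
  refine ⟨c, EReal.coe_lt_coe_iff.1 hc1, fun a ha hεa => ?_⟩
  have h : (⨅ a ∈ {a ∈ Θ | ε < ‖a - θ‖}, ((risk P ρ a : ℝ) : EReal)) ≤ (risk P ρ a : EReal) :=
    iInf₂_le a ⟨ha, hεa⟩
  exact (EReal.coe_lt_coe_iff.1 (hc2.trans_le h)).le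

lemma risk_le_of_gap
    (hsep : ∀ ε > 0, ∃ c > risk P ρ θ, ∀ a ∈ Θ, ε < ‖a - θ‖ → c ≤ risk P ρ a)
    {a : EuclideanSpace ℝ (Fin d)} (ha : a ∈ Θ) : risk P ρ θ ≤ risk P ρ a := by
  by_cases h : a = θ
  · rw [h]
  · have hpos : 0 < ‖a - θ‖ := norm_pos_iff.2 (sub_ne_zero.2 h)
    obtain ⟨c, hc, h1⟩ := hsep (‖a - θ‖ / 2) (by linarith)
    exact hc.le.trans (h1 a ha (by linarith))

variable {δ : ℝ} {F : EuclideanSpace ℝ (Fin d) → ℝ}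

lemma norm_fderiv_fderiv_psi_le {x a : EuclideanSpace ℝ (Fin d)} {B : ℝ}
    (h : ∀ p q s : Fin d, |psiDDot ρ x a p q s| ≤ B) :
    ‖fderiv ℝ (fderiv ℝ (psi ρ x)) a‖ ≤ (d : ℝ) ^ 3 * |B| :=
  norm_clm₂_le _ fun k l p => h k l p

lemma norm_fderiv_psi_le (x a : EuclideanSpace ℝ (Fin d)) :
    ‖fderiv ℝ (psi ρ x) a‖ ≤ ∑ k, ∑ l, |psiDot ρ x a k l| :=
  norm_clm_le_sum _

/-- The coordinates of the second order Taylor remainder of `ψ(x, ·)` at `θ`. -/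
lemma abs_psi_sub_sub_le (hψdiff : ∀ x, ∀ a ∈ Metric.ball θ δ, DifferentiableAt ℝ (psi ρ x) a)
    (hψdiff2 : ∀ x, ∀ a ∈ Metric.ball θ δ, DifferentiableAt ℝ (fderiv ℝ (psi ρ x)) a)
    (hψdom : ∀ x, ∀ a ∈ Metric.ball θ δ, ∀ p q s : Fin d, |psiDDot ρ x a p q s| ≤ F x)
    (x : EuclideanSpace ℝ (Fin d)) {a : EuclideanSpace ℝ (Fin d)} (ha : a ∈ Metric.ball θ δ)
    (k : Fin d) :
    |psi ρ x a k - psi ρ x θ k - ∑ l, psiDot ρ x θ k l * (a - θ) l|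
      ≤ ‖a - θ‖ ^ 2 * (d : ℝ) ^ 3 * |F x| := by
  have h := norm_sub_sub_fderiv_le (hψdiff x) (hψdiff2 x)
    (fun b hb => norm_fderiv_fderiv_psi_le (hψdom x b hb)) ha
  have h2 := (euclidean_abs_apply_le_norm _ k).trans h
  rw [PiLp.sub_apply, PiLp.sub_apply, clm_apply_apply_eq_sum] at h2
  refine h2.trans (le_of_eq (by ring))

lemma memLp_psiDot_bound [IsProbabilityMeasure P] (hF : MemLp F 2 P)
    (hψdot : ∀ p q : Fin d, MemLp (fun x => psiDot ρ x θ p q) 2 P) (c : ℝ) :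
    MemLp (fun x => ∑ k, ∑ l, |psiDot ρ x θ k l| + (d : ℝ) ^ 3 * |F x| * c) 2 P := by
  refine MemLp.add ?_ ?_
  · exact memLp_finsetSum _ fun k _ => memLp_finsetSum _ fun l _ => (hψdot k l).abs
  · exact (hF.abs.const_mul ((d : ℝ) ^ 3)).mul_const c

/-- The score is centered, since `θ` minimizes the risk. -/
lemma integral_inner_psi_eq_zero [IsProbabilityMeasure P] (hδ : 0 < δ)
    (hball : Metric.ball θ δ ⊆ Θ)
    (hmin : ∀ a ∈ Θ, risk P ρ θ ≤ risk P ρ a) (hρ2 : ∀ a ∈ Θ, MemLp (fun x => ρ x a) 2 P)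
    (hρdiff : ∀ x, ∀ a ∈ Metric.ball θ δ, DifferentiableAt ℝ (ρ x) a)
    (hψdiff : ∀ x, ∀ a ∈ Metric.ball θ δ, DifferentiableAt ℝ (psi ρ x) a)
    (hψdiff2 : ∀ x, ∀ a ∈ Metric.ball θ δ, DifferentiableAt ℝ (fderiv ℝ (psi ρ x)) a)
    (hF : MemLp F 2 P)
    (hψdom : ∀ x, ∀ a ∈ Metric.ball θ δ, ∀ p q s : Fin d, |psiDDot ρ x a p q s| ≤ F x)
    (hψdot : ∀ p q : Fin d, MemLp (fun x => psiDot ρ x θ p q) 2 P)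
    {u : EuclideanSpace ℝ (Fin d)} (hψ : MemLp (fun x => inner ℝ u (psi ρ x θ)) 2 P) :
    ∫ x, inner ℝ u (psi ρ x θ) ∂P = 0 := by
  have hθ : θ ∈ Θ := hball (Metric.mem_ball_self hδ)
  set K : EuclideanSpace ℝ (Fin d) → ℝ :=
    fun x => ∑ k, ∑ l, |psiDot ρ x θ k l| + (d : ℝ) ^ 3 * |F x| * δ with hK
  have hKi : Integrable K P := (memLp_psiDot_bound hF hψdot δ).integrable (by norm_num)
  have hρi : ∀ a ∈ Θ, Integrable (fun x => ρ x a) P := fun a ha => (hρ2 a ha).integrable (by norm_num)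
  have hψi : Integrable (fun x => inner ℝ u (psi ρ x θ)) P := hψ.integrable (by norm_num)
  -- The risk increment along `t • u` is nonnegative and at most `t` times the mean score plus a
  -- quadratic term. The denominator `‖u‖ + 1` keeps `θ + t • u` in the ball, also when `u = 0`.
  refine eq_zero_of_forall_nonneg_quadratic (δ := δ / (‖u‖ + 1)) (Q := ‖u‖ ^ 2 * ∫ x, K x ∂P)
    (by positivity) fun t ht => ?_
  have hu : 0 ≤ ‖u‖ := norm_nonneg u
  have ha : θ + t • u ∈ Metric.ball θ δ := by
    rw [Metric.mem_ball, dist_eq_norm, add_sub_cancel_left, norm_smul, Real.norm_eq_abs]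
    rw [lt_div_iff₀ (by positivity)] at ht
    nlinarith [abs_nonneg t]
  have hpt : ∀ x, ρ x (θ + t • u) - ρ x θ ≤ t * inner ℝ u (psi ρ x θ) + ‖u‖ ^ 2 * t ^ 2 * K x := by
    intro x
    have h := (abs_le.1 (abs_sub_sub_inner_gradient_le (hρdiff x) (hψdiff x) (hψdiff2 x)
      (fun b hb => norm_fderiv_fderiv_psi_le (hψdom x b hb)) ha)).2
    rw [add_sub_cancel_left, real_inner_comm, real_inner_smul_left, norm_smul, Real.norm_eq_abs,
      mul_pow, sq_abs] at h
    have h2 : ‖fderiv ℝ (gradient (ρ x)) θ‖ + (d : ℝ) ^ 3 * |F x| * δ ≤ K x :=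
      add_le_add (norm_fderiv_psi_le x θ) le_rfl
    have h3 := mul_le_mul_of_nonneg_right h2 (show 0 ≤ t ^ 2 * ‖u‖ ^ 2 by positivity)
    simp only [psi]
    linarith
  have hint := integral_mono ((hρi _ (hball ha)).sub (hρi θ hθ))
    ((hψi.const_mul t).add (hKi.const_mul (‖u‖ ^ 2 * t ^ 2))) hpt
  simp only [Pi.sub_apply, Pi.add_apply] at hint
  rw [integral_sub (hρi _ (hball ha)) (hρi θ hθ),
    integral_add (hψi.const_mul t) (hKi.const_mul (‖u‖ ^ 2 * t ^ 2)), integral_const_mul,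
    integral_const_mul] at hint
  have := hmin _ (hball ha)
  simp only [risk] at this
  linarith

lemma matV_isHermitian (hρdiff : ∀ x, ∀ᶠ a in 𝓝 θ, DifferentiableAt ℝ (ρ x) a)
    (hψdiff : ∀ x, DifferentiableAt ℝ (psi ρ x) θ) : (matV P ρ θ).IsHermitian := by
  ext k l
  simp only [Matrix.conjTranspose_apply, star_trivial, matV, Matrix.of_apply]
  refine integral_congr_ae (ae_of_all _ fun x => ?_)
  have h := inner_fderiv_gradient_comm (hρdiff x) (hψdiff x) (EuclideanSpace.single l (1 : ℝ))
    (EuclideanSpace.single k (1 : ℝ))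
  simp only [psiDot, Matrix.of_apply]
  rw [EuclideanSpace.inner_single_right, EuclideanSpace.inner_single_right] at h
  simp only [conj_trivial, one_mul] at h
  exact h.symm

lemma abs_risk_sub_le {k : EuclideanSpace ℝ (Fin d) → ℝ} {r : ℝ} [IsProbabilityMeasure P]
    (hρ2 : ∀ a ∈ Θ, MemLp (fun x => ρ x a) 2 P)
    (hρHolder : ∀ x, ∀ a₁ ∈ Θ, ∀ a₂ ∈ Θ, |ρ x a₁ - ρ x a₂| ≤ k x * ‖a₁ - a₂‖ ^ r)
    (hk : MemLp k 2 P) {a b : EuclideanSpace ℝ (Fin d)} (ha : a ∈ Θ) (hb : b ∈ Θ) :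
    |risk P ρ a - risk P ρ b| ≤ (∫ x, |k x| ∂P) * ‖a - b‖ ^ r := by
  have hρi : ∀ a ∈ Θ, Integrable (fun x => ρ x a) P := fun a ha => (hρ2 a ha).integrable (by norm_num)
  rw [risk, risk, ← integral_sub (hρi a ha) (hρi b hb), ← integral_mul_const]
  have hki : Integrable (fun x => |k x|) P := hk.abs.integrable (by norm_num)
  refine norm_integral_le_of_norm_le (f := fun x => ρ x a - ρ x b) (hki.mul_const _)
    (ae_of_all _ fun x => (hρHolder x a ha b hb).trans ?_)
  exact mul_le_mul_of_nonneg_right (le_abs_self _) (Real.rpow_nonneg (norm_nonneg _) _)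

end Score

/-! ### Limiting covariance of the cluster scores -/

section Covariance

variable {d : ℕ} {Ω : Type*} [MeasurableSpace Ω] {μ : Measure Ω} [IsProbabilityMeasure μ]
  {P : Measure (EuclideanSpace ℝ (Fin d))} {θ : EuclideanSpace ℝ (Fin d)}
  {ρ : EuclideanSpace ℝ (Fin d) → EuclideanSpace ℝ (Fin d) → ℝ}
  {m : ℕ → ℕ} {X : (i : ℕ) → Fin (m i) → Ω → EuclideanSpace ℝ (Fin d)}
  {w : (i : ℕ) → Fin (m i) → ℝ}
  (hXmeas : ∀ i j, Measurable (X i j)) (hXlaw : ∀ i j, μ.map (X i j) = P)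
  (hψ : ∀ k, MemLp (fun x => psi ρ x θ k) 2 P)

include hXmeas hXlaw hψ

omit [IsProbabilityMeasure μ] in
/-- The cross moments of the cluster sums of the score split into diagonal and off-diagonal
parts. -/
lemma integral_clusterSum_mul (i : ℕ) (k l : Fin d) :
    ∫ ω, clusterSum w X (fun x => psi ρ x θ k) i ω * clusterSum w X (fun x => psi ρ x θ l) i ω ∂μ
      = (∑ j, w i j ^ 2) * matB P ρ θ k l +
        ∑ j, ∑ j' ∈ univ.erase j, w i j * w i j' * crossMoment μ ρ θ (X i j) (X i j') k l := by
  have hint : ∀ j j', Integrable (fun ω => psi ρ (X i j ω) θ k * psi ρ (X i j' ω) θ l) μ :=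
    fun j j' => (memLp_comp_obs hXmeas hXlaw (hψ k) i j).integrable_mul
      (memLp_comp_obs hXmeas hXlaw (hψ l) i j')
  have h1 : ∀ ω, clusterSum w X (fun x => psi ρ x θ k) i ω
      * clusterSum w X (fun x => psi ρ x θ l) i ω
      = ∑ j, ∑ j', w i j * w i j' * (psi ρ (X i j ω) θ k * psi ρ (X i j' ω) θ l) := by
    intro ω
    simp only [clusterSum, sum_mul_sum]
    exact sum_congr rfl fun j _ => sum_congr rfl fun j' _ => by ring
  simp_rw [h1]
  rw [integral_finsetSum _ fun j _ => integrable_finsetSum _ fun j' _ => (hint j j').const_mul _,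
    sum_mul, ← sum_add_distrib]
  refine sum_congr rfl fun j _ => ?_
  rw [integral_finsetSum _ fun j' _ => (hint j j').const_mul _, ← add_sum_erase _ _ (mem_univ j)]
  congr 1
  · rw [integral_const_mul, sq, matB, Matrix.of_apply]
    congr 1
    exact integral_comp_obs hXmeas hXlaw (f := fun x => psi ρ x θ k * psi ρ x θ l)
      ((hψ k).aestronglyMeasurable.mul (hψ l).aestronglyMeasurable) i j
  · exact sum_congr rfl fun j' _ => by rw [integral_const_mul, crossMoment, Matrix.of_apply]

variable {cw : ℝ} {Cw : Matrix (Fin d) (Fin d) ℝ}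
  (hA2a : Tendsto (fun n : ℕ => (1 / (totalSize m n : ℝ)) * ∑ i ∈ range n, ∑ j, (w i j) ^ 2)
    atTop (𝓝 cw))
  (hA2b : Tendsto (fun n : ℕ => (1 / (totalSize m n : ℝ)) • ∑ i ∈ range n,
      ∑ j, ∑ j' ∈ univ.erase j, (w i j * w i j') • crossMoment μ ρ θ (X i j) (X i j'))
    atTop (𝓝 Cw))

include hA2a hA2b

omit [IsProbabilityMeasure μ] in
lemma tendsto_mean_integral_clusterSum_mul (k l : Fin d) :
    Tendsto (fun n : ℕ => (1 / (totalSize m n : ℝ)) * ∑ i ∈ range n,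
      ∫ ω, clusterSum w X (fun x => psi ρ x θ k) i ω * clusterSum w X (fun x => psi ρ x θ l) i ω ∂μ)
      atTop (𝓝 ((cw • matB P ρ θ + Cw) k l)) := by
  have h1 := (hA2a.mul_const (matB P ρ θ k l)).add
    ((tendsto_pi_nhds.1 ((tendsto_pi_nhds.1 hA2b) k)) l)
  rw [Matrix.add_apply, Matrix.smul_apply, smul_eq_mul]
  refine h1.congr fun n => ?_
  simp_rw [integral_clusterSum_mul hXmeas hXlaw hψ]
  rw [sum_add_distrib, mul_add, ← sum_mul, mul_assoc]
  congr 1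
  simp only [Matrix.smul_apply, Matrix.sum_apply, smul_eq_mul]

omit [IsProbabilityMeasure μ] in
lemma tendsto_mean_integral_clusterSum_sq (u : EuclideanSpace ℝ (Fin d)) :
    Tendsto (fun n : ℕ => (1 / (totalSize m n : ℝ)) * ∑ i ∈ range n,
      ∫ ω, clusterSum w X (fun x => inner ℝ u (psi ρ x θ)) i ω ^ 2 ∂μ)
      atTop (𝓝 (u.ofLp ⬝ᵥ (cw • matB P ρ θ + Cw).mulVec u.ofLp)) := by
  have h1 : ∀ i, ∫ ω, clusterSum w X (fun x => inner ℝ u (psi ρ x θ)) i ω ^ 2 ∂μ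
      = ∑ k, ∑ l, u k * u l * ∫ ω, clusterSum w X (fun x => psi ρ x θ k) i ω
          * clusterSum w X (fun x => psi ρ x θ l) i ω ∂μ := by
    intro i
    have hint : ∀ k l, Integrable (fun ω => clusterSum w X (fun x => psi ρ x θ k) i ω
          * clusterSum w X (fun x => psi ρ x θ l) i ω) μ := fun k l =>
      (memLp_clusterSum hXmeas hXlaw (hψ k) i).integrable_mul
        (memLp_clusterSum hXmeas hXlaw (hψ l) i)
    have h2 : ∀ ω, clusterSum w X (fun x => inner ℝ u (psi ρ x θ)) i ω
        = ∑ k, u k * clusterSum w X (fun x => psi ρ x θ k) i ω := by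
      intro ω
      simp only [clusterSum, mul_sum]
      rw [sum_comm]
      refine sum_congr rfl fun j _ => ?_
      rw [PiLp.inner_apply, mul_sum]
      refine sum_congr rfl fun k _ => ?_
      simp only [RCLike.inner_apply, conj_trivial]
      ring
    simp_rw [h2, sq, sum_mul_sum]
    rw [integral_finsetSum]
    · refine sum_congr rfl fun k _ => ?_
      rw [integral_finsetSum]
      · refine sum_congr rfl fun l _ => ?_
        rw [← integral_const_mul]
        exact integral_congr_ae (ae_of_all _ fun ω => by ring)
      · intro l _
        refine ((hint k l).const_mul (u k * u l)).congr (ae_of_all _ fun ω => by ring)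
    · intro k _
      refine integrable_finsetSum _ fun l _ => ?_
      refine ((hint k l).const_mul (u k * u l)).congr (ae_of_all _ fun ω => by ring)
  have h2 : u.ofLp ⬝ᵥ (cw • matB P ρ θ + Cw).mulVec u.ofLp
      = ∑ k, ∑ l, u k * u l * (cw • matB P ρ θ + Cw) k l := by
    simp only [dotProduct, Matrix.mulVec, mul_sum]
    exact sum_congr rfl fun k _ => sum_congr rfl fun l _ => by ring
  rw [h2]
  refine (tendsto_finsetSum _ fun k _ => tendsto_finsetSum _ fun l _ =>
    (tendsto_mean_integral_clusterSum_mul hXmeas hXlaw hψ hA2a hA2b k l).const_mul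
      (u k * u l)).congr fun n => ?_
  simp_rw [h1]
  rw [sum_comm (s := range n), mul_sum]
  refine sum_congr rfl fun k _ => ?_
  rw [sum_comm (s := range n), mul_sum]
  refine sum_congr rfl fun l _ => ?_
  rw [← mul_sum]
  ring

omit [IsProbabilityMeasure μ] in
/-- The limiting covariance matrix of the weighted scores is positive semidefinite. -/
lemma posSemidef_scoreCov : (cw • matB P ρ θ + Cw).PosSemidef := by
  refine Matrix.PosSemidef.of_dotProduct_mulVec_nonneg ?_ fun u => ?_
  -- Symmetry of `Cw` is not assumed: the whole matrix is a limit of averaged second moments of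
  -- cluster sums, which are symmetric with nonnegative quadratic forms, and both properties survive
  -- the limit.
  · ext k l
    rw [Matrix.conjTranspose_apply, star_trivial]
    refine tendsto_nhds_unique
      (tendsto_mean_integral_clusterSum_mul hXmeas hXlaw hψ hA2a hA2b l k)
      ((tendsto_mean_integral_clusterSum_mul hXmeas hXlaw hψ hA2a hA2b k l).congr fun n => ?_)
    simp_rw [mul_comm]
  · have h := tendsto_mean_integral_clusterSum_sq hXmeas hXlaw hψ hA2a hA2b (WithLp.toLp 2 u)
    refine ge_of_tendsto' (x := atTop) (by simpa using h) fun n => ?_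
    exact mul_nonneg (by positivity) (sum_nonneg fun i _ => integral_nonneg fun ω => sq_nonneg _)

-- As `V` is symmetric, the sandwich by `V⁻¹` is a congruence, which preserves positivity.
omit [IsProbabilityMeasure μ] in
lemma posSemidef_asympCov (hV : (matV P ρ θ).IsHermitian) : (asympCov P ρ θ cw Cw).PosSemidef := by
  have h := (posSemidef_scoreCov hXmeas hXlaw hψ hA2a hA2b).mul_mul_conjTranspose_same
    (matV P ρ θ)⁻¹
  rwa [hV.inv.eq] at h

end Covariance

/-! ### Inverting the linearized estimating equation -/

section Linearization

variable {d : ℕ}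

lemma toEuclideanCLM_apply_coord (A : Matrix (Fin d) (Fin d) ℝ) (u : EuclideanSpace ℝ (Fin d))
    (k : Fin d) : Matrix.toEuclideanCLM (𝕜 := ℝ) A u k = ∑ l, A k l * u l := by
  rw [Matrix.ofLp_toEuclideanCLM]
  rfl

/-- Approximate solutions of a linear equation, up to an error that is negligible compared to the
solution, are equivalent to the exact solution. -/
lemma exists_norm_add_inv_le {V : Matrix (Fin d) (Fin d) ℝ} (hV : IsUnit V)
    {h S : ℕ → EuclideanSpace ℝ (Fin d)} {e : ℕ → ℝ} (he : Tendsto e atTop (𝓝 0))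
    (hb : ∀ᶠ n in atTop, ∀ k, |S n k + ∑ l, V k l * h n l| ≤ e n * ‖h n‖) :
    ∃ e' : ℕ → ℝ, Tendsto e' atTop (𝓝 0) ∧ ∀ᶠ n in atTop,
      ‖h n + Matrix.toEuclideanCLM (𝕜 := ℝ) V⁻¹ (S n)‖
        ≤ e' n * ‖Matrix.toEuclideanCLM (𝕜 := ℝ) V⁻¹ (S n)‖ := by
  set L := Matrix.toEuclideanCLM (𝕜 := ℝ) V⁻¹ with hL
  set e₀ : ℕ → ℝ := fun n => |‖L‖ * (d * e n)| with he₀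
  have he₀t : Tendsto e₀ atTop (𝓝 0) := by
    have := ((he.const_mul (d : ℝ)).const_mul ‖L‖).abs
    rwa [mul_zero, mul_zero, abs_zero] at this
  have hLV : ∀ u, L (Matrix.toEuclideanCLM (𝕜 := ℝ) V u) = u := by
    intro u
    have h1 : L * Matrix.toEuclideanCLM (𝕜 := ℝ) V = 1 := by
      rw [hL, ← map_mul, Matrix.nonsing_inv_mul _ ((Matrix.isUnit_iff_isUnit_det V).1 hV), map_one]
    exact congrArg (fun T : EuclideanSpace ℝ (Fin d) →L[ℝ] EuclideanSpace ℝ (Fin d) => T u) h1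
  -- From `‖h + L S‖ ≤ e₀ ‖h‖ ≤ e₀ (‖h + L S‖ + ‖L S‖)` the first term on the right is absorbed once
  -- `e₀ < 1/2`, at the cost of a factor `2`.
  refine ⟨fun n => 2 * e₀ n, by simpa using he₀t.const_mul 2, ?_⟩
  filter_upwards [hb, he₀t.eventually (gt_mem_nhds (show (0 : ℝ) < 1 / 2 by norm_num))] with n h1 h2
  have h3 : h n + L (S n) = L (S n + Matrix.toEuclideanCLM (𝕜 := ℝ) V (h n)) := by
    rw [map_add, hLV, add_comm]
  have h4 : ‖h n + L (S n)‖ ≤ e₀ n * ‖h n‖ := by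
    rw [h3]
    calc _ ≤ ‖L‖ * ‖S n + Matrix.toEuclideanCLM (𝕜 := ℝ) V (h n)‖ := L.le_opNorm _
      _ ≤ ‖L‖ * ∑ k : Fin d, e n * ‖h n‖ := by
        refine mul_le_mul_of_nonneg_left ((euclidean_norm_le_sum_abs _).trans
          (sum_le_sum fun k _ => ?_)) (norm_nonneg _)
        rw [PiLp.add_apply, toEuclideanCLM_apply_coord]
        exact h1 k
      _ = ‖L‖ * (d * e n) * ‖h n‖ := by
        simp
        ring
      _ ≤ _ := mul_le_mul_of_nonneg_right (le_abs_self _) (norm_nonneg _)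
  have h5 : ‖h n‖ ≤ ‖h n + L (S n)‖ + ‖L (S n)‖ := by
    simpa using norm_sub_le (h n + L (S n)) (L (S n))
  have h6 : 0 ≤ e₀ n := abs_nonneg _
  nlinarith [norm_nonneg (h n + L (S n)), norm_nonneg (L (S n))]

end Linearization

/-! ### The estimating equation -/

section Stationarity

variable {d : ℕ} {Ω : Type*} {Θ : Set (EuclideanSpace ℝ (Fin d))}
  {ρ : EuclideanSpace ℝ (Fin d) → EuclideanSpace ℝ (Fin d) → ℝ}
  {m : ℕ → ℕ} {X : (i : ℕ) → Fin (m i) → Ω → EuclideanSpace ℝ (Fin d)}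
  {w : (i : ℕ) → Fin (m i) → ℝ}

/-- The estimating equation: the weighted score vanishes at interior minimizers. -/
lemma weightedMean_psi_eq_zero {a : EuclideanSpace ℝ (Fin d)} (ha : Θ ∈ 𝓝 a) {n : ℕ} {ω : Ω}
    (hmin : IsMinOn (weightedRisk m w X ρ n ω) Θ a) (hρ : ∀ x, DifferentiableAt ℝ (ρ x) a)
    (k : Fin d) : weightedMean w X (fun x => psi ρ x a k) n ω = 0 := by
  have h1 : HasFDerivAt (weightedRisk m w X ρ n ω) ((1 / (totalSize m n : ℝ)) •
      ∑ i ∈ range n, ∑ j, w i j • fderiv ℝ (ρ (X i j ω)) a) a := by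
    have h2 : ∀ i ∈ range n, HasFDerivAt (fun b => ∑ j, w i j * ρ (X i j ω) b)
        (∑ j, w i j • fderiv ℝ (ρ (X i j ω)) a) a := fun i _ =>
      HasFDerivAt.fun_sum fun j _ => (hρ _).hasFDerivAt.const_mul (w i j)
    exact (HasFDerivAt.fun_sum h2).const_mul _
  have h3 := (hmin.isLocalMin ha).hasFDerivAt_eq_zero h1
  have h4 := congrArg (fun T : EuclideanSpace ℝ (Fin d) →L[ℝ] ℝ => T (EuclideanSpace.single k 1)) h3
  have h5 : ∀ x, psi ρ x a k = fderiv ℝ (ρ x) a (EuclideanSpace.single k 1) := by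
    intro x
    rw [psi_apply_eq_inner, real_inner_comm, psi, gradient, ← InnerProductSpace.toDual_apply_apply,
      LinearIsometryEquiv.apply_symm_apply]
  simp only [weightedMean, clusterSum, h5]
  simpa [_root_.sum_apply] using h4

end Stationarity

/-! ### Linearization of the estimation error -/

section Asymptotics

variable {d : ℕ} {Ω : Type*} {P : Measure (EuclideanSpace ℝ (Fin d))}
  {θ : EuclideanSpace ℝ (Fin d)}
  {ρ : EuclideanSpace ℝ (Fin d) → EuclideanSpace ℝ (Fin d) → ℝ}
  {m : ℕ → ℕ} {X : (i : ℕ) → Fin (m i) → Ω → EuclideanSpace ℝ (Fin d)}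
  {w : (i : ℕ) → Fin (m i) → ℝ}

variable (ρ θ X w) in
/-- The weighted mean of the score vectors at `θ`. -/
def scoreMean (n : ℕ) (ω : Ω) : EuclideanSpace ℝ (Fin d) :=
  WithLp.toLp 2 fun k => weightedMean w X (fun x => psi ρ x θ k) n ω

variable (P ρ θ X w) in
/-- The linearization of the normalized estimation error. -/
def linearTerm (n : ℕ) (ω : Ω) : EuclideanSpace ℝ (Fin d) :=
  -(√(totalSize m n : ℝ) •
    Matrix.toEuclideanCLM (𝕜 := ℝ) (matV P ρ θ)⁻¹ (scoreMean θ ρ X w n ω))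

/-- Cramér–Wold reduction: `V⁻¹` is self-adjoint and moves onto `t`, leaving a scalar sum of
independent cluster sums to which Lyapunov's theorem applies. -/
lemma inner_linearTerm (hV : (matV P ρ θ).IsHermitian) (n : ℕ) (ω : Ω)
    (t : EuclideanSpace ℝ (Fin d)) :
    inner ℝ (linearTerm P θ ρ X w n ω) t = √(1 / (totalSize m n : ℝ)) * ∑ i ∈ range n,
      clusterSum w X
        (fun x => inner ℝ (-Matrix.toEuclideanCLM (𝕜 := ℝ) (matV P ρ θ)⁻¹ t) (psi ρ x θ)) i ω := by
  have hN : √(totalSize m n : ℝ) * (1 / (totalSize m n : ℝ)) = √(1 / (totalSize m n : ℝ)) := by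
    rw [Real.sqrt_div zero_le_one, Real.sqrt_one]
    -- With no observations both sides vanish, by the convention `1 / 0 = 0`.
    rcases eq_or_ne (totalSize m n) 0 with h | h
    · simp [h]
    · have h0 : (0 : ℝ) < totalSize m n := by exact_mod_cast Nat.pos_of_ne_zero h
      have h1 : √(totalSize m n : ℝ) ≠ 0 := (Real.sqrt_pos.2 h0).ne'
      field_simp
      exact Real.sq_sqrt h0.le
  have hsa : IsSelfAdjoint (Matrix.toEuclideanCLM (𝕜 := ℝ) (matV P ρ θ)⁻¹) := by
    have : IsSelfAdjoint (matV P ρ θ)⁻¹ := hV.inv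
    exact this.map (Matrix.toEuclideanCLM (𝕜 := ℝ) (n := Fin d))
  set u := Matrix.toEuclideanCLM (𝕜 := ℝ) (matV P ρ θ)⁻¹ t with hu
  have h1 : inner ℝ (Matrix.toEuclideanCLM (𝕜 := ℝ) (matV P ρ θ)⁻¹ (scoreMean θ ρ X w n ω)) t
      = inner ℝ (scoreMean θ ρ X w n ω) u := by
    rw [hu, ← ContinuousLinearMap.adjoint_inner_left, hsa.adjoint_eq]
  have h2 : inner ℝ (scoreMean θ ρ X w n ω) u
      = weightedMean w X (fun x => inner ℝ u (psi ρ x θ)) n ω := by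
    simp only [PiLp.inner_apply, scoreMean, RCLike.inner_apply, conj_trivial]
    rw [weightedMean_sum]
    refine sum_congr rfl fun k _ => ?_
    rw [← weightedMean_const_mul]
    simp_rw [mul_comm]
  have h3 : ∀ i, clusterSum w X (fun x => inner ℝ (-u) (psi ρ x θ)) i ω
      = -clusterSum w X (fun x => inner ℝ u (psi ρ x θ)) i ω := by
    intro i
    simp [clusterSum, inner_neg_left]
  simp_rw [h3]
  rw [linearTerm, inner_neg_left, real_inner_smul_left, h1, h2, weightedMean, ← hN, sum_neg_distrib]
  ring

/-- The variance counterpart of `inner_linearTerm`: it matches the Gaussian limit in direction `t`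
with the score variance in direction `-V⁻¹ t`. -/
lemma dotProduct_asympCov_mulVec (hV : (matV P ρ θ).IsHermitian) (cw : ℝ)
    (Cw : Matrix (Fin d) (Fin d) ℝ) (t : EuclideanSpace ℝ (Fin d)) :
    t.ofLp ⬝ᵥ (asympCov P ρ θ cw Cw).mulVec t.ofLp
      = (-Matrix.toEuclideanCLM (𝕜 := ℝ) (matV P ρ θ)⁻¹ t).ofLp ⬝ᵥ
        (cw • matB P ρ θ + Cw).mulVec (-Matrix.toEuclideanCLM (𝕜 := ℝ) (matV P ρ θ)⁻¹ t).ofLp := by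
  have hT : ((matV P ρ θ)⁻¹).transpose = (matV P ρ θ)⁻¹ := by
    have := hV.inv.eq
    rwa [Matrix.conjTranspose_eq_transpose_of_trivial] at this
  rw [asympCov, WithLp.ofLp_neg, Matrix.ofLp_toEuclideanCLM, Matrix.mulVec_neg, neg_dotProduct_neg,
    ← Matrix.mulVec_mulVec, ← Matrix.mulVec_mulVec, Matrix.dotProduct_mulVec, ← Matrix.mulVec_transpose,
    hT]

/-- The difference between the normalized estimation error and its linearization is negligible
compared to the linearization. -/
lemma tendsto_smul_sub_linearTerm (hw : ∀ i j, 0 < w i j) {δ : ℝ} (hδ : 0 < δ)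
    {F : EuclideanSpace ℝ (Fin d) → ℝ}
    (hψdiff : ∀ x, ∀ a ∈ Metric.ball θ δ, DifferentiableAt ℝ (psi ρ x) a)
    (hψdiff2 : ∀ x, ∀ a ∈ Metric.ball θ δ, DifferentiableAt ℝ (fderiv ℝ (psi ρ x)) a)
    (hψdom : ∀ x, ∀ a ∈ Metric.ball θ δ, ∀ p q s : Fin d, |psiDDot ρ x a p q s| ≤ F x)
    (hV : IsUnit (matV P ρ θ)) {φ : ℕ → ℕ} {ω : Ω}
    (hdot : ∀ k l, Tendsto (fun n => weightedMean w X (fun x => psiDot ρ x θ k l) (φ n) ω) atTop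
      (𝓝 (matV P ρ θ k l))) {c : ℝ}
    (hFlim : Tendsto (fun n => weightedMean w X (fun x => |F x|) (φ n) ω) atTop (𝓝 c))
    {a : ℕ → EuclideanSpace ℝ (Fin d)} (ha : Tendsto a atTop (𝓝 θ))
    (hstat : ∀ᶠ n in atTop, ∀ k, weightedMean w X (fun x => psi ρ x (a n) k) (φ n) ω = 0) :
    Tendsto (fun n => (1 + ‖linearTerm P θ ρ X w (φ n) ω‖)⁻¹ •
      (√(totalSize m (φ n) : ℝ) • (a n - θ) - linearTerm P θ ρ X w (φ n) ω)) atTop (𝓝 0) := by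
  set V := matV P ρ θ
  set A : ℕ → Fin d → Fin d → ℝ := fun n k l => weightedMean w X (fun x => psiDot ρ x θ k l) (φ n) ω
  have hh : Tendsto (fun n => ‖a n - θ‖) atTop (𝓝 0) := by
    simpa using (ha.sub_const θ).norm
  -- Two errors, each with one factor `‖a n - θ‖` taken out: the fluctuation of the averaged
  -- Jacobian, and the second order remainder.
  set e : ℕ → ℝ := fun n => ∑ k, ∑ l, |A n k l - V k l| +
    ‖a n - θ‖ * ((d : ℝ) ^ 3 * weightedMean w X (fun x => |F x|) (φ n) ω)
  have he : Tendsto e atTop (𝓝 0) := by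
    have h1 : Tendsto (fun n => ∑ k, ∑ l, |A n k l - V k l|) atTop
        (𝓝 (∑ k, ∑ l, |V k l - V k l|)) :=
      tendsto_finsetSum _ fun k _ => tendsto_finsetSum _ fun l _ => ((hdot k l).sub_const _).abs
    have h2 := h1.add (hh.mul (hFlim.const_mul ((d : ℝ) ^ 3)))
    simpa using h2
  have hb : ∀ᶠ n in atTop, ∀ k,
      |scoreMean θ ρ X w (φ n) ω k + ∑ l, V k l * (a n - θ) l| ≤ e n * ‖a n - θ‖ := by
    filter_upwards [hstat, ha.eventually (Metric.ball_mem_nhds θ hδ)] with n h1 h2 k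
    have h3 := abs_weightedMean_le (X := X) hw
      (fun x => abs_psi_sub_sub_le hψdiff hψdiff2 hψdom x h2 k) (φ n) ω
    rw [weightedMean_sub, weightedMean_sub, weightedMean_sum, weightedMean_const_mul, h1 k] at h3
    have h4 : ∀ l, weightedMean w X (fun x => psiDot ρ x θ k l * (a n - θ) l) (φ n) ω
        = A n k l * (a n - θ) l := by
      intro l
      simp_rw [mul_comm _ ((a n - θ) l)]
      exact weightedMean_const_mul w X _ _ _ _
    simp_rw [h4] at h3
    have h5 : |∑ l, (A n k l - V k l) * (a n - θ) l|
        ≤ (∑ k, ∑ l, |A n k l - V k l|) * ‖a n - θ‖ := by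
      calc _ ≤ ∑ l, |A n k l - V k l| * ‖a n - θ‖ := by
            refine (abs_sum_le_sum_abs _ _).trans (sum_le_sum fun l _ => ?_)
            rw [abs_mul]
            exact mul_le_mul_of_nonneg_left (euclidean_abs_apply_le_norm _ l) (abs_nonneg _)
        _ = (∑ l, |A n k l - V k l|) * ‖a n - θ‖ := (sum_mul _ _ _).symm
        _ ≤ _ := mul_le_mul_of_nonneg_right
            (single_le_sum (f := fun k => ∑ l, |A n k l - V k l|)
              (fun k _ => sum_nonneg fun l _ => abs_nonneg _) (mem_univ k)) (norm_nonneg _)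
    -- The leading `0` is the weighted score at `a n`, so the first bracket is the Taylor remainder
    -- bounded in `h3`.
    have h6 : scoreMean θ ρ X w (φ n) ω k + ∑ l, V k l * (a n - θ) l
        = -(0 - weightedMean w X (fun x => psi ρ x θ k) (φ n) ω - ∑ l, A n k l * (a n - θ) l)
          - ∑ l, (A n k l - V k l) * (a n - θ) l := by
      simp only [scoreMean, sub_mul, sum_sub_distrib]
      ring
    rw [h6]
    refine (abs_sub _ _).trans ?_
    rw [abs_neg]
    refine (add_le_add h3 h5).trans (le_of_eq ?_)
    simp only [e]
    ring
  obtain ⟨e', he', hb'⟩ := exists_norm_add_inv_le hV he hb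
  refine squeeze_zero_norm' ?_ (by simpa using he'.abs)
  filter_upwards [hb'] with n hn
  set L := Matrix.toEuclideanCLM (𝕜 := ℝ) V⁻¹ (scoreMean θ ρ X w (φ n) ω) with hL
  have hlin : linearTerm P θ ρ X w (φ n) ω = -(√(totalSize m (φ n) : ℝ) • L) := rfl
  set s := √(totalSize m (φ n) : ℝ)
  have hs : 0 ≤ s := Real.sqrt_nonneg _
  rw [hlin, norm_neg, sub_neg_eq_add, ← smul_add, norm_smul, norm_smul, norm_smul, norm_inv,
    Real.norm_eq_abs, Real.norm_eq_abs, abs_of_nonneg hs, abs_of_nonneg (by positivity),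
    inv_mul_le_iff₀ (by positivity)]
  have h1 := mul_le_mul_of_nonneg_left (hn.trans (mul_le_mul_of_nonneg_right (le_abs_self (e' n))
    (norm_nonneg L))) hs
  have h2 : 0 ≤ |e' n| := abs_nonneg _
  nlinarith

end Asymptotics

/-! ### Central limit theorem for the linear term -/

section CentralLimit

variable {d : ℕ} {Ω : Type*} [MeasurableSpace Ω] {μ : Measure Ω} [IsProbabilityMeasure μ]
  {P : Measure (EuclideanSpace ℝ (Fin d))} [IsProbabilityMeasure P]
  {θ : EuclideanSpace ℝ (Fin d)}
  {ρ : EuclideanSpace ℝ (Fin d) → EuclideanSpace ℝ (Fin d) → ℝ}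
  {m : ℕ → ℕ} {X : (i : ℕ) → Fin (m i) → Ω → EuclideanSpace ℝ (Fin d)}
  {w : (i : ℕ) → Fin (m i) → ℝ}

omit [IsProbabilityMeasure μ] [IsProbabilityMeasure P] in
lemma measurable_linearTerm (hXmeas : ∀ i j, Measurable (X i j))
    (hmeas : ∀ u, Measurable fun x => inner ℝ u (psi ρ x θ)) (n : ℕ) :
    Measurable (linearTerm P θ ρ X w n) := by
  have h1 : ∀ k, Measurable fun x => psi ρ x θ k := fun k => by
    simpa only [psi_apply_eq_inner] using hmeas (EuclideanSpace.single k 1)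
  have h2 : Measurable (scoreMean θ ρ X w n) := by
    refine (WithLp.measurable_toLp 2 _).comp (measurable_pi_lambda _ fun k => ?_)
    refine Measurable.const_mul ?_ _
    refine Finset.measurable_sum _ fun i _ => Finset.measurable_sum _ fun j _ => ?_
    exact ((h1 k).comp (hXmeas i j)).const_mul _
  exact (((Matrix.toEuclideanCLM (𝕜 := ℝ) (matV P ρ θ)⁻¹).continuous.measurable.comp h2).const_smul
    (√(totalSize m n : ℝ))).neg

/-- **Central limit theorem** for the linearization of the weighted M-estimator. -/
theorem tendstoInDistribution_linearTerm (hm : ∀ i, 1 ≤ m i) (hw : ∀ i j, 0 < w i j)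
    (hXmeas : ∀ i j, Measurable (X i j)) (hXlaw : ∀ i j, μ.map (X i j) = P)
    (hXindep : iIndepFun (fun (i : ℕ) (ω : Ω) (j : Fin (m i)) => X i j ω) μ)
    (hmeas : ∀ u, Measurable fun x => inner ℝ u (psi ρ x θ))
    (hcent : ∀ u, ∫ x, inner ℝ u (psi ρ x θ) ∂P = 0) (hV : (matV P ρ θ).IsHermitian) {cw : ℝ}
    (hA2a : Tendsto (fun n : ℕ => (1 / (totalSize m n : ℝ)) * ∑ i ∈ range n, ∑ j, (w i j) ^ 2)
      atTop (𝓝 cw))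
    {Cw : Matrix (Fin d) (Fin d) ℝ}
    (hA2b : Tendsto (fun n : ℕ => (1 / (totalSize m n : ℝ)) • ∑ i ∈ range n,
        ∑ j, ∑ j' ∈ univ.erase j, (w i j * w i j') • crossMoment μ ρ θ (X i j) (X i j'))
      atTop (𝓝 Cw))
    {p B : ℝ} (hp2 : 2 < p) (hp3 : p ≤ 3)
    (hB : ∀ n, (1 / (totalSize m n : ℝ)) * ∑ i ∈ range n, (∑ j, w i j) ^ p ≤ B)
    (hp : ∀ u, Integrable (fun x => |inner ℝ u (psi ρ x θ)| ^ p) P)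
    (hL2 : ∀ u, MemLp (fun x => inner ℝ u (psi ρ x θ)) 2 P) :
    TendstoInDistribution (linearTerm P θ ρ X w) atTop
      (id : EuclideanSpace ℝ (Fin d) → EuclideanSpace ℝ (Fin d)) (fun _ => μ)
      (multivariateGaussian 0 (asympCov P ρ θ cw Cw)) where
  forall_aemeasurable n := (measurable_linearTerm hXmeas hmeas n).aemeasurable
  aemeasurable_limit := aemeasurable_id
  tendsto := by
    have hψ : ∀ k, MemLp (fun x => psi ρ x θ k) 2 P := fun k => by
      simpa only [psi_apply_eq_inner] using hL2 (EuclideanSpace.single k 1)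
    have hpsd := posSemidef_asympCov hXmeas hXlaw hψ hA2a hA2b hV
    refine ProbabilityMeasure.tendsto_iff_tendsto_charFun.2 fun t => ?_
    simp only [ProbabilityMeasure.coe_mk, Measure.map_id]
    rw [charFun_multivariateGaussian hpsd, dotProduct_asympCov_mulVec hV]
    set u := -Matrix.toEuclideanCLM (𝕜 := ℝ) (matV P ρ θ)⁻¹ t with hu
    set f : EuclideanSpace ℝ (Fin d) → ℝ := fun x => inner ℝ u (psi ρ x θ) with hf
    have hc : ∀ n, √(1 / (totalSize m n : ℝ)) ^ 2 = 1 / (totalSize m n : ℝ) := fun n =>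
      Real.sq_sqrt (by positivity)
    have hW := sum_weights_pos hm hw
    have hφ0 : Tendsto (fun n => √(1 / (totalSize m n : ℝ)) ^ (p - 2)) atTop (𝓝 0) := by
      have h1 : Tendsto (fun n => 1 / (totalSize m n : ℝ)) atTop (𝓝 0) :=
        tendsto_const_nhds.div_atTop (tendsto_natCast_atTop_atTop.comp
          (tendsto_atTop_mono (le_totalSize hm) tendsto_id))
      have h2 := (Real.continuous_sqrt.tendsto 0).comp h1
      rw [Real.sqrt_zero] at h2
      have h3 := (Real.continuousAt_rpow_const 0 (p - 2) (Or.inr (by linarith))).tendsto.comp h2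
      rwa [Real.zero_rpow (by linarith)] at h3
    have hlyap : Tendsto (fun n => √(1 / (totalSize m n : ℝ)) ^ p * ∑ i ∈ range n, (∑ j, w i j) ^ p)
        atTop (𝓝 0) := by
      have h1 := hφ0.mul_const B
      rw [zero_mul] at h1
      have h0 : ∀ n, 0 ≤ ∑ i ∈ range n, (∑ j, w i j) ^ p := fun n =>
        sum_nonneg fun i _ => Real.rpow_nonneg (hW i).le _
      refine squeeze_zero (fun n => mul_nonneg (Real.rpow_nonneg (Real.sqrt_nonneg _) _) (h0 n))
        (fun n => ?_) h1
      -- Two of the `p` powers rebuild the mean bounded by `B`; the other `p - 2 > 0` powers tend to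
      -- `0`.
      have h2 : √(1 / (totalSize m n : ℝ)) ^ p
          = √(1 / (totalSize m n : ℝ)) ^ (p - 2) * (1 / (totalSize m n : ℝ)) := by
        have h3 := Real.rpow_add' (Real.sqrt_nonneg (1 / (totalSize m n : ℝ)))
          (show p - 2 + 2 ≠ 0 by linarith)
        rwa [sub_add_cancel, Real.rpow_two, hc n] at h3
      rw [h2, mul_assoc]
      exact mul_le_mul_of_nonneg_left (hB n) (Real.rpow_nonneg (Real.sqrt_nonneg _) _)
    have hJ2 : 0 ≤ ∫ x, f x ^ 2 ∂P := integral_nonneg fun x => sq_nonneg _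
    have hJp : 0 ≤ ∫ x, |f x| ^ p ∂P := integral_nonneg fun x => Real.rpow_nonneg (abs_nonneg _) _
    have key := tendsto_charFun_scaled_sum (Y := clusterSum w X f)
      (iIndepFun_clusterSum hXindep (hmeas u)) hp2.le hp3
      (fun i => memLp_clusterSum hXmeas hXlaw (hL2 u) i)
      (fun i => by
        rw [integral_clusterSum hXmeas hXlaw ((hL2 u).integrable (by norm_num)), hcent u, mul_zero])
      (fun i => (integral_abs_clusterSum_rpow_le hXmeas hXlaw hm hw
        (hmeas u).aestronglyMeasurable (by linarith) (hp u) i).1)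
      (v := fun i => ∑ j, w i j) (fun i => (hW i).le)
      -- One constant serving for both the second and the `p`-th moments.
      (K := ∫ x, f x ^ 2 ∂P + ∫ x, |f x| ^ p ∂P) (add_nonneg hJ2 hJp)
      (fun i => by
        have := integral_clusterSum_sq_le hXmeas hXlaw hm hw (hL2 u) i
        nlinarith [mul_nonneg (sq_nonneg (∑ j, w i j)) hJp])
      (fun i => by
        have := (integral_abs_clusterSum_rpow_le hXmeas hXlaw hm hw
          (hmeas u).aestronglyMeasurable (by linarith) (hp u) i).2
        nlinarith [mul_nonneg (Real.rpow_nonneg (hW i).le p) hJ2])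
      (c := fun n => √(1 / (totalSize m n : ℝ))) (fun n => Real.sqrt_nonneg _)
      ((tendsto_mean_integral_clusterSum_sq hXmeas hXlaw hψ hA2a hA2b u).congr fun n => by rw [hc n])
      hlyap
    have hlim : Complex.exp (((inner ℝ t (0 : EuclideanSpace ℝ (Fin d)) : ℝ) : ℂ) * Complex.I
        - ((u.ofLp ⬝ᵥ (cw • matB P ρ θ + Cw).mulVec u.ofLp : ℝ) : ℂ) / 2)
        = Complex.exp (-((u.ofLp ⬝ᵥ (cw • matB P ρ θ + Cw).mulVec u.ofLp / 2 : ℝ) : ℂ)) := by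
      simp
    rw [hlim]
    refine key.congr fun n => ?_
    have hmeas' := measurable_linearTerm (P := P) (w := w) hXmeas hmeas n
    have hsum : Measurable fun ω => √(1 / (totalSize m n : ℝ)) * ∑ i ∈ range n,
        clusterSum w X f i ω :=
      (Finset.measurable_sum _ fun i _ => Finset.measurable_sum _ fun j _ =>
        ((hmeas u).comp (hXmeas i j)).const_mul _).const_mul _
    rw [charFun_apply_real, charFun_apply, integral_map hsum.aemeasurable (by fun_prop),
      integral_map hmeas'.aemeasurable (by fun_prop)]
    refine integral_congr_ae (ae_of_all _ fun ω => ?_)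
    simp only [inner_linearTerm hV n ω t, Complex.ofReal_one, one_mul]
    rfl

end CentralLimit

end WeightedM

end

/-! ### Assembly: consistency, linearization and Slutsky's theorem -/

theorem theorem3p2 {d : ℕ} {Ω : Type*} [MeasurableSpace Ω]
    (μ : Measure Ω) [IsProbabilityMeasure μ]
    -- the common law `P_θ` of the observations, the parameter set `Θ`, the true parameter `θ`
    (P : Measure (EuclideanSpace ℝ (Fin d))) [IsProbabilityMeasure P]
    (Θ : Set (EuclideanSpace ℝ (Fin d))) (hΘconv : Convex ℝ Θ) (hΘbdd : Bornology.IsBounded Θ)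
    (θ : EuclideanSpace ℝ (Fin d)) (hθ : θ ∈ interior Θ)
    -- independent clusters of sizes `m_i ≥ 1`
    (m : ℕ → ℕ) (hm : ∀ i, 1 ≤ m i)
    (X : (i : ℕ) → Fin (m i) → Ω → EuclideanSpace ℝ (Fin d))
    (hXmeas : ∀ i j, Measurable (X i j))
    (hXlaw : ∀ i j, μ.map (X i j) = P)
    (hXindep : iIndepFun (fun (i : ℕ) (ω : Ω) (j : Fin (m i)) => X i j ω) μ)
    (hXpairs : ∀ i, ∀ j j' k k' : Fin (m i), j ≠ j' → k ≠ k' →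
      μ.map (fun ω => (X i j ω, X i j' ω)) = μ.map (fun ω => (X i k ω, X i k' ω)))
    (ℓ : ℝ) (hℓ : 0 < ℓ)
    (hN : Tendsto (fun n : ℕ => (totalSize m n : ℝ) / n) atTop (𝓝 ℓ))
    -- positive weights
    (w : (i : ℕ) → Fin (m i) → ℝ) (hw : ∀ i j, 0 < w i j)
    -- the objective function
    (ρ : EuclideanSpace ℝ (Fin d) → EuclideanSpace ℝ (Fin d) → ℝ)
    (hρmeas : ∀ a ∈ Θ, Measurable (fun x => ρ x a))
    -- first set of assumptions, (a) to (d)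
    (hA1a : ∀ ε > 0, ((risk P ρ θ : ℝ) : EReal) <
      ⨅ a ∈ {a ∈ Θ | ε < ‖a - θ‖}, ((risk P ρ a : ℝ) : EReal))
    (hA1b : ∀ a ∈ Θ, MemLp (fun x => ρ x a) 2 P)
    (hA1c : Tendsto (fun n : ℕ => (1 / (totalSize m n : ℝ)) * ∑ i ∈ range n, ∑ j, w i j)
      atTop (𝓝 1))
    (hA1d : Summable (fun i : ℕ => (∑ j, w i j) ^ 2 / ((i : ℝ) + 1) ^ 2))
    -- Hölder condition
    (k : EuclideanSpace ℝ (Fin d) → ℝ) (r : ℝ) (hr0 : 0 < r) (hr1 : r ≤ 1)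
    (hρHolder : ∀ x, ∀ a₁ ∈ Θ, ∀ a₂ ∈ Θ, |ρ x a₁ - ρ x a₂| ≤ k x * ‖a₁ - a₂‖ ^ r)
    (hk : MemLp k 2 P)
    -- `ρ(x, ·)` is differentiable and its gradient `ψ(x, ·)` twice differentiable near `θ`, with
    -- second order partial derivatives dominated by a square-integrable function
    (U : Set (EuclideanSpace ℝ (Fin d))) (hU : U ∈ 𝓝 θ)
    (hρdiff : ∀ x, ∀ a ∈ U, DifferentiableAt ℝ (ρ x) a)
    (hψdiff : ∀ x, ∀ a ∈ U, DifferentiableAt ℝ (psi ρ x) a)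
    (hψdiff2 : ∀ x, ∀ a ∈ U, DifferentiableAt ℝ (fderiv ℝ (psi ρ x)) a)
    (F : EuclideanSpace ℝ (Fin d) → ℝ) (hF : MemLp F 2 P)
    (hψdom : ∀ x, ∀ a ∈ U, ∀ p q s : Fin d, |psiDDot ρ x a p q s| ≤ F x)
    (hψdot : ∀ p q : Fin d, MemLp (fun x => psiDot ρ x θ p q) 2 P)
    (hV : IsUnit (matV P ρ θ))
    -- second set of assumptions, (a) to (c)
    (cw : ℝ)
    (hA2a : Tendsto (fun n : ℕ => (1 / (totalSize m n : ℝ)) * ∑ i ∈ range n, ∑ j, (w i j) ^ 2)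
      atTop (𝓝 cw))
    (Cw : Matrix (Fin d) (Fin d) ℝ)
    (hA2b : Tendsto (fun n : ℕ => (1 / (totalSize m n : ℝ)) • ∑ i ∈ range n,
        ∑ j, ∑ j' ∈ univ.erase j, (w i j * w i j') • crossMoment μ ρ θ (X i j) (X i j'))
      atTop (𝓝 Cw))
    (η : ℝ) (hη : 0 < η)
    (hA2c : ∃ L : ℝ, Tendsto (fun n : ℕ =>
      (1 / (totalSize m n : ℝ)) * ∑ i ∈ range n, (∑ j, w i j) ^ (2 + η)) atTop (𝓝 L))
    (hA2c' : Integrable (fun x => ‖psi ρ x θ‖ ^ (2 + η)) P)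
    -- the weighted M-estimators: minimizers over `Θ` of the weighted empirical criterion
    (θhat : ℕ → Ω → EuclideanSpace ℝ (Fin d))
    (hθhat_meas : ∀ n, AEMeasurable (θhat n) μ)
    (hθhat : ∀ᵐ ω ∂μ, ∀ᶠ n in atTop,
      θhat n ω ∈ Θ ∧ IsMinOn (weightedRisk m w X ρ n ω) Θ (θhat n ω)) :
    (asympCov P ρ θ cw Cw).PosSemidef ∧
    TendstoInDistribution
      (fun (n : ℕ) (ω : Ω) => √(totalSize m n : ℝ) • (θhat n ω - θ)) atTop
      (id : EuclideanSpace ℝ (Fin d) → EuclideanSpace ℝ (Fin d)) (fun _ => μ)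
      (multivariateGaussian 0 (asympCov P ρ θ cw Cw)) := by
  have hΘ : Θ ∈ 𝓝 θ := mem_interior_iff_mem_nhds.1 hθ
  obtain ⟨δ, hδ, hball⟩ := Metric.mem_nhds_iff.1 (inter_mem hΘ hU)
  have hballΘ : Metric.ball θ δ ⊆ Θ := fun a ha => (hball ha).1
  have hρd : ∀ x, ∀ a ∈ Metric.ball θ δ, DifferentiableAt ℝ (ρ x) a :=
    fun x a ha => hρdiff x a (hball ha).2
  have hψd : ∀ x, ∀ a ∈ Metric.ball θ δ, DifferentiableAt ℝ (psi ρ x) a :=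
    fun x a ha => hψdiff x a (hball ha).2
  have hψd2 : ∀ x, ∀ a ∈ Metric.ball θ δ, DifferentiableAt ℝ (fderiv ℝ (psi ρ x)) a :=
    fun x a ha => hψdiff2 x a (hball ha).2
  have hdom : ∀ x, ∀ a ∈ Metric.ball θ δ, ∀ p q s : Fin d, |psiDDot ρ x a p q s| ≤ F x :=
    fun x a ha => hψdom x a (hball ha).2
  have hθball : θ ∈ Metric.ball θ δ := Metric.mem_ball_self hδ
  have hθΘ : θ ∈ Θ := hballΘ hθball
  have hsep := exists_risk_gap hA1a
  have hmeas := measurable_inner_psi hθ hρmeas fun x => hρd x θ hθball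
  have hL2 := memLp_inner_psi (p := 2 + η) hmeas (by linarith) hA2c'
  have hcent : ∀ u, ∫ x, inner ℝ u (psi ρ x θ) ∂P = 0 := fun u =>
    integral_inner_psi_eq_zero hδ hballΘ (fun a ha => risk_le_of_gap hsep ha) hA1b hρd hψd hψd2 hF
      hdom hψdot (hL2 u)
  have hVh : (matV P ρ θ).IsHermitian := matV_isHermitian
    (fun x => mem_of_superset (Metric.ball_mem_nhds θ hδ) fun a ha => hρd x a ha) fun x => hψd x θ hθball
  have hψ : ∀ k, MemLp (fun x => psi ρ x θ k) 2 P := fun k => by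
    simpa only [psi_apply_eq_inner] using hL2 (EuclideanSpace.single k 1)
  obtain ⟨L, hL⟩ := hA2c
  obtain ⟨B, hB⟩ := exists_bound_mean_rpow hm (fun i => (sum_weights_pos hm hw i).le) hL
  -- The law of large numbers needs bounded means of squared cluster weights; they follow from the
  -- means of order `2 + η`.
  have hB2 : ∀ n, (1 / (totalSize m n : ℝ)) * ∑ i ∈ range n, (∑ j, w i j) ^ 2 ≤ B := by
    simpa using hB 2 (by norm_num) (by linarith)
  -- The Taylor bound for the exponential requires an exponent at most `3`, so `η` is truncated at
  -- `1`.
  have hmin1 : min η 1 ≤ η := min_le_left _ _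
  have hmin2 : min η 1 ≤ 1 := min_le_right _ _
  have hmin0 : 0 < min η 1 := lt_min hη one_pos
  have hclt := tendstoInDistribution_linearTerm hm hw hXmeas hXlaw hXindep hmeas hcent hVh hA2a hA2b
    (p := 2 + min η 1) (by linarith) (by linarith) (hB _ (by linarith) (by linarith))
    (integrable_abs_inner_psi_rpow hmeas (by linarith) (by linarith) hA2c') hL2
  refine ⟨posSemidef_asympCov hXmeas hXlaw hψ hA2a hA2b hVh, ?_⟩
  set D : ℕ → Ω → EuclideanSpace ℝ (Fin d) :=
    fun n ω => √(totalSize m n : ℝ) • (θhat n ω - θ) with hD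
  -- The linearization error is small relative to the linear term; dividing by `1 + ‖linearTerm‖`
  -- makes it tend to `0` without a separate tightness argument.
  set R : ℕ → Ω → EuclideanSpace ℝ (Fin d) := fun n ω =>
    (1 + ‖linearTerm P θ ρ X w n ω‖)⁻¹ • (D n ω - linearTerm P θ ρ X w n ω) with hR
  have hDmeas : ∀ n, AEMeasurable (D n) μ := fun n =>
    ((hθhat_meas n).sub_const θ).const_smul (√(totalSize m n : ℝ))
  have hRmeas : ∀ n, AEMeasurable (R n) μ := fun n => by
    have h1 := (measurable_linearTerm (P := P) (w := w) hXmeas hmeas n).aemeasurable (μ := μ)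
    exact ((h1.norm.const_add 1).inv).smul ((hDmeas n).sub h1)
  have hRlim : TendstoInMeasure μ R atTop fun _ => 0 := by
    rw [exists_seq_tendstoInMeasure_atTop_iff fun n => (hRmeas n).aestronglyMeasurable]
    intro ns hns
    -- Convergence in measure is tested on subsequences: any `ns` is thinned along the squares,
    -- which makes it sparse enough for the almost sure law of large numbers.
    refine ⟨fun k => (k + 1) ^ 2, fun a b hab => Nat.pow_lt_pow_left (by omega) two_ne_zero, ?_⟩
    set φ : ℕ → ℕ := fun k => ns ((k + 1) ^ 2) with hφd
    have hφ : ∀ k, (k + 1) ^ 2 ≤ φ k := fun k => hns.le_apply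
    have hφt : Tendsto φ atTop atTop := tendsto_atTop_mono (fun k => by
      have := hφ k
      show k ≤ φ k
      nlinarith) tendsto_id
    have hlln : ∀ f : EuclideanSpace ℝ (Fin d) → ℝ, MemLp f 2 P → ∀ᵐ ω ∂μ,
        Tendsto (fun k => weightedMean w X f (φ k) ω) atTop (𝓝 (∫ x, f x ∂P)) := fun f hf =>
      ae_tendsto_weightedMean hXmeas hXlaw hm hw hXindep hA1c hB2 hf hφ
    have htb : TotallyBounded Θ :=
      (hΘbdd.isCompact_closure.totallyBounded).subset subset_closure
    obtain ⟨T, hTΘ, hTc, hTnet⟩ := exists_countable_nets htb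
    have hρT := (ae_ball_iff hTc).2 fun a ha => hlln (fun x => ρ x a) (hA1b a (hTΘ ha))
    have hdotT : ∀ᵐ ω ∂μ, ∀ p q, Tendsto
        (fun k => weightedMean w X (fun x => psiDot ρ x θ p q) (φ k) ω) atTop
        (𝓝 (matV P ρ θ p q)) := by
      rw [ae_all_iff]
      intro p
      rw [ae_all_iff]
      exact fun q => hlln _ (hψdot p q)
    filter_upwards [hρT, hdotT, hlln _ hk.abs, hlln _ hF.abs, hθhat] with ω h1 h2 h3 h4 h5
    have h6 : ∀ᶠ k in atTop, θhat (φ k) ω ∈ Θ ∧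
        IsMinOn (weightedRisk m w X ρ (φ k) ω) Θ (θhat (φ k) ω) := hφt.eventually h5
    have hunif : TendstoUniformlyOn (fun k => weightedRisk m w X ρ (φ k) ω) (risk P ρ) atTop Θ := by
      refine tendstoUniformlyOn_of_holder hr0 hTΘ hTnet (fun n a ha b hb => ?_)
        (fun a ha b hb => abs_risk_sub_le hA1b hρHolder hk ha hb)
        (integral_nonneg fun x => abs_nonneg _) h3 h1
      have h7 := abs_weightedMean_le (X := X) hw (f := fun x => ρ x a - ρ x b)
        (g := fun x => ‖a - b‖ ^ r * |k x|) (fun x => (hρHolder x a ha b hb).trans (by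
          rw [mul_comm]
          exact mul_le_mul_of_nonneg_left (le_abs_self _) (Real.rpow_nonneg (norm_nonneg _) _)))
        (φ n) ω
      rw [weightedMean_sub, weightedMean_const_mul, mul_comm] at h7
      exact h7
    have hcons : Tendsto (fun k => θhat (φ k) ω) atTop (𝓝 θ) := tendsto_of_isMinOn hθΘ hunif hsep h6
    refine tendsto_smul_sub_linearTerm hw hδ hψd hψd2 hdom hV h2 h4 hcons ?_
    filter_upwards [h6, hcons.eventually (Metric.isOpen_ball.mem_nhds hθball)] with n h8 h9 k
    exact weightedMean_psi_eq_zero (mem_of_superset (Metric.isOpen_ball.mem_nhds h9) hballΘ) h8.2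
      (fun x => hρd x _ h9) k
  -- This map recovers the normalized error from `linearTerm` and `R`, and it is the identity in its
  -- first variable when the second is `0`.
  have hslutsky := hclt.continuous_comp_prodMk_of_tendstoInMeasure_const
    (g := fun z : EuclideanSpace ℝ (Fin d) × EuclideanSpace ℝ (Fin d) => z.1 + (1 + ‖z.1‖) • z.2)
    (by fun_prop) hRlim hRmeas
  convert! hslutsky using 2 with n
  · ext1 ω
    have h0 : 1 + ‖linearTerm P θ ρ X w n ω‖ ≠ 0 := by positivity
    simp only [hR, smul_smul, mul_inv_cancel₀ h0, one_smul, add_sub_cancel]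
  · ext1 z
    simp
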